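/- **Theorem 1 (Consistency).** Let $\mathbb X$ be a finite set, $w:\mathbb X\times\mathbb X\to\mathbb R^d$ a known function and write $\beta=(\beta_1,\beta_2,\beta_3)\in\mathbb R^{d}\times\mathbb R\times\mathbb R$. For each $n$ consider the directed network formation game with agents $1,\dots,n$, public attributes $X=(X_1,\dots,X_n)\in\mathbb X^n$, private types $A_0=(A_{10},\dots,A_{n0})\in\mathbb R^n$, private shocks $\varepsilon=(\varepsilon_{ij})$, a public signal $\nu$ and a network $G=(G_{ij})_{i\ne j}\in\{0,1\}^{n(n-1)}$. Agent $i$ chooses $G_i=(G_{ij})_{j\ne i}$ and has payoff $$U_i=\sum_{j\ne i}G_{ij}\Big(w(X_i,X_j)'\beta_{1}+A_{i0}+G_{ji}\beta_{2}+\tfrac1{n-2}\sum_{k\ne i,j}G_{jk}\beta_{3}+\varepsilon_{ij}\Big)$$ at the true parameter $\beta=\beta_0$. Assume: 1. $X_1,\dots,X_n$ are independent; given $X$, the $A_{i0}$ are independent, and the law of $A_{i0}$ is a function $F_{A|X}$, common to all agents, of $X$ and the own attribute $X_i$, concentrated on a compact set $\mathbb A\subset\mathbb R$ that does not depend on $n$;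 the $\varepsilon_{ij}$ are i.i.d. with the standard logistic distribution, and $\varepsilon$ is independent of $(X,A_0,\nu)$. 2. (Equilibrium selection) Given $X$, a belief profile assigns to each agent $i$ and each type $a$ a probability distribution $\sigma_i(\cdot\mid X,a)$ on the actions of $i$. It is an equilibrium if $\sigma_i(g\mid X,a)$ equals, for all $i,a,g$, the probability (over $\varepsilon_i$) that $g$ is the unique maximizer of the expected payoff of $i$ of type $a$, when the others' types are drawn independently from their conditional laws given $X$ and they play according to $\sigma$. It is symmetric if the probability that $i$ proposes a link to $j$ given $X$ and $A_{i0}=a$ depends only on $(X_i,X_j)$ and $a$. For all large $n$ there is a measurable selection $\sigma^*=\lambda_n(X,\nu)$ of symmetric equilibria such that almost surely every $G_i$ maximizes the expected payoff of $i$, given $X$, $A_{i0}$ and $\varepsilon_i$, against $\sigma^*$. 3. $\beta_0\in\operatorname{int}\mathbb B$, with $\mathbb B\subset\mathbb R^{d+2}$ compact. 4. (Joint identification) For a matrix $q=(q_{ij})$ put $$Q_{ij}(\beta,a,q)=\Lambda\Big(w(X_i,X_j)'\beta_1+a+q_{ji}\beta_2+\tfrac1{n-2}\sum_{k\ne i,j}q_{jk}\beta_3\Big),\qquad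 \Lambda(t)=\frac{e^t}{1+e^t},$$ $$\mathcal L_n(\beta,A,q)=\frac1{n(n-1)}\sum_i\sum_{j\ne i}\big[G_{ij}\ln Q_{ij}(\beta,A_i,q)+(1-G_{ij})\ln(1-Q_{ij}(\beta,A_i,q))\big].$$ Let $q_{ij}$ be the probability, given $X$ and the selected equilibrium $\sigma^*$, that $i$ proposes a link to $j$ (with $A_{i0}$ integrated out under its conditional law given $X$), and let $\bar{\mathcal L}_n(\beta,A)=\mathbb E[\mathcal L_n(\beta,A,q)\mid X,A_0,\nu]$. Then, for large $n$, $(\beta_0,A_0)$ is an identifiably unique (well-separated) maximizer of $\bar{\mathcal L}_n$ on $\mathbb B\times\mathbb A^n$: for all $r,\delta>0$ there is $\eta>0$ such that for all large $n$, with probability at least $1-\delta$, $$\bar{\mathcal L}_n(\beta,A)\le\bar{\mathcal L}_n(\beta_0,A_0)-\eta\quad\text{for all }(\beta,A)\in\mathbb B\times\mathbb A^n\text{ with }\|\beta-\beta_0\|+\tfrac1n\sum_i|A_i-A_{i0}|\ge r.$$ Let $\hat q_{ij}=\hat q_{n,st}$ for $X_i=x_s$, $X_j=x_t$, where $\hat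 q_{n,st}$ is the fraction of the ordered pairs $(k,l)$, $k\ne l$, with $X_k=x_s$ and $X_l=x_t$ for which $G_{kl}=1$, and let $(\hat\beta,\hat A)$ be any maximizer of $\mathcal L_n(\beta,A,\hat q)$ over $\mathbb B\times\mathbb A^n$. Then, as $n\to\infty$, $$\hat\beta\xrightarrow{p}\beta_0\qquad\text{and}\qquad \max_{1\le i\le n}|\hat A_i-A_{i0}|\xrightarrow{p}0 .$$ -/

import Mathlib

open MeasureTheory ProbabilityTheory Filter Topology

namespace NetFormation

noncomputable section

/-- The logistic cumulative distribution function `t ↦ 1 / (1 + exp (-t))`. -/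
def logisticCDF : StieltjesFunction ℝ where
  toFun := Real.sigmoid
  mono' := Real.sigmoid_monotone
  right_continuous' := fun _ => continuous_sigmoid.continuousWithinAt

/-- The (standard) logistic distribution on the real line. -/
def logistic : Measure ℝ := logisticCDF.measure

instance : IsProbabilityMeasure logistic :=
  logisticCDF.isProbabilityMeasure Real.tendsto_sigmoid_atBot Real.tendsto_sigmoid_atTop

/-- Actions of agent `i`: a link proposal or none to each other agent, never to oneself. -/
abbrev Action {n : ℕ} (i : Fin n) : Type := {g : Fin n → Bool // g i = false}

/-- A directed network: one action for each agent. -/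
abbrev Network (n : ℕ) : Type := (i : Fin n) → Action i

instance {n : ℕ} (i : Fin n) : Nonempty (Action i) := ⟨⟨fun _ => false, rfl⟩⟩

/-- The link indicator `G i j` as a real number. -/
def link {n : ℕ} (g : Network n) (i j : Fin n) : ℝ := if (g i).1 j = true then 1 else 0

/-- Parameters `β = (β₁, β₂, β₃)`: `β₁ ∈ ℝ^d` for the homophily term, `β₂` for reciprocity,
`β₃` for the popularity term. -/
abbrev Param (d : ℕ) : Type := (Fin d → ℝ) × ℝ × ℝ

section Game

variable {𝕏 : Type*} {d n : ℕ}

/-- `w(xᵢ, xⱼ)'β₁ + a + m j i β₂ + (n - 2)⁻¹ ∑_{k ≠ i, j} m j k β₃`, for a matrix `m` of links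
or of link probabilities. -/
def index (w : 𝕏 → 𝕏 → Fin d → ℝ) (β : Param d) (x : Fin n → 𝕏) (m : Fin n → Fin n → ℝ)
    (a : ℝ) (i j : Fin n) : ℝ :=
  w (x i) (x j) ⬝ᵥ β.1 + a + m j i * β.2.1
    + ((n : ℝ) - 2)⁻¹ * (∑ k ∈ Finset.univ.filter (fun k => k ≠ i ∧ k ≠ j), m j k) * β.2.2

/-- The payoff of agent `i` of private type `a` with shocks `e` in the network `g`. -/
def payoff (w : 𝕏 → 𝕏 → Fin d → ℝ) (β : Param d) (x : Fin n → 𝕏) (i : Fin n) (a : ℝ)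
    (e : Fin n → ℝ) (g : Network n) : ℝ :=
  ∑ j, link g i j * (index w β x (link g) a i j + e j)

/-- A belief profile, given the public attributes: `σ i a g` is the probability that agent `i`
of private type `a` plays the action `g`. -/
abbrev Belief (n : ℕ) : Type := (i : Fin n) → ℝ → Action i → ℝ

/-- Expected payoff of agent `i` from the action `gi`, where the other agents' private types are
independent with laws `μA j` and they play according to `σ`. -/
def expectedPayoff (w : 𝕏 → 𝕏 → Fin d → ℝ) (β : Param d) (x : Fin n → 𝕏)
    (μA : Fin n → Measure ℝ) (σ : Belief n) (i : Fin n) (a : ℝ) (e : Fin n → ℝ)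
    (gi : Action i) : ℝ :=
  ∑ g : Network n, if g i = gi then
    (∏ j ∈ Finset.univ.erase i, ∫ t, σ j t (g j) ∂(μA j)) * payoff w β x i a e g else 0

/-- Bayesian equilibrium: every `σ i a` is a probability distribution on actions, and it agrees
with the probability, over i.i.d. logistic shocks, that the action is the best reply. -/
def IsEquilibrium (w : 𝕏 → 𝕏 → Fin d → ℝ) (β : Param d) (x : Fin n → 𝕏)
    (μA : Fin n → Measure ℝ) (σ : Belief n) : Prop :=
  (∀ (i : Fin n) (a : ℝ), (∀ g, 0 ≤ σ i a g) ∧ ∑ g, σ i a g = 1) ∧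
  ∀ (i : Fin n) (a : ℝ) (g : Action i),
    σ i a g = (Measure.pi (fun _ : Fin n => logistic)).real
      {e | ∀ g', g' ≠ g →
        expectedPayoff w β x μA σ i a e g' < expectedPayoff w β x μA σ i a e g}

/-- Probability that agent `i` of private type `a` proposes a link to `j`. -/
def linkProb (σ : Belief n) (i j : Fin n) (a : ℝ) : ℝ :=
  ∑ g : Action i, if g.1 j = true then σ i a g else 0

/-- Ordered pairs of agents with the same observed attributes, and the same private type of the
proposer, have the same link probability. -/
def IsSymmetric (x : Fin n → 𝕏) (σ : Belief n) : Prop :=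
  ∀ i j k l : Fin n, i ≠ j → k ≠ l → x i = x k → x j = x l →
    ∀ a : ℝ, linkProb σ i j a = linkProb σ k l a

/-- `q i j`: the probability that `i` proposes a link to `j`, given the public attributes and
the belief profile, the private type being integrated out. -/
def meanLinkProb (μA : Fin n → Measure ℝ) (σ : Belief n) (i j : Fin n) : ℝ :=
  ∫ a, linkProb σ i j a ∂(μA i)

/-- The logit conditional choice probability `Q i j (β, a, q)`. -/
def choiceProb (w : 𝕏 → 𝕏 → Fin d → ℝ) (β : Param d) (x : Fin n → 𝕏)
    (q : Fin n → Fin n → ℝ) (a : ℝ) (i j : Fin n) : ℝ :=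
  Real.sigmoid (index w β x q a i j)

/-- The normalized log-likelihood `L_n(β, A, q)` of the network `g`. -/
def logLik (w : 𝕏 → 𝕏 → Fin d → ℝ) (x : Fin n → 𝕏) (g : Network n) (β : Param d)
    (A : Fin n → ℝ) (q : Fin n → Fin n → ℝ) : ℝ :=
  ((n : ℝ) * ((n : ℝ) - 1))⁻¹ * ∑ i, ∑ j ∈ Finset.univ.erase i,
    (link g i j * Real.log (choiceProb w β x q (A i) i j)
      + (1 - link g i j) * Real.log (1 - choiceProb w β x q (A i) i j))

/-- First step: the empirical frequency of proposals from attribute `s` to attribute `t`. -/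
def frequency [DecidableEq 𝕏] (x : Fin n → 𝕏) (g : Network n) (s t : 𝕏) : ℝ :=
  (∑ i, ∑ j ∈ Finset.univ.erase i, if x i = s ∧ x j = t then link g i j else 0)
    / (∑ i, ∑ j ∈ Finset.univ.erase i, if x i = s ∧ x j = t then 1 else 0)

/-- The first-step estimate `q̂ i j`, read off at the attributes of `i` and `j`. -/
def qHat [DecidableEq 𝕏] (x : Fin n → 𝕏) (g : Network n) (i j : Fin n) : ℝ :=
  frequency x g (x i) (x j)

/-- `(β, A)` maximizes the log-likelihood with `q̂` plugged in, over `β ∈ B` and `A ∈ 𝔸ⁿ`. -/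
def IsTwoStepMLE [DecidableEq 𝕏] (w : 𝕏 → 𝕏 → Fin d → ℝ) (B : Set (Param d)) (𝔸 : Set ℝ)
    (x : Fin n → 𝕏) (g : Network n) (β : Param d) (A : Fin n → ℝ) : Prop :=
  β ∈ B ∧ (∀ i, A i ∈ 𝔸) ∧
    ∀ β' ∈ B, ∀ A' : Fin n → ℝ, (∀ i, A' i ∈ 𝔸) →
      logLik w x g β' A' (qHat x g) ≤ logLik w x g β A (qHat x g)

end Game

/-- The random objects of the `n`-agent game: observed attributes, private types, public signal,
payoff shocks and the network. -/
structure Sample (𝕏 V Ω : Type*) (n : ℕ) where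
  X : Ω → Fin n → 𝕏
  A : Ω → Fin n → ℝ
  signal : Ω → V
  shock : Ω → Fin n → Fin n → ℝ
  G : Ω → Network n

section Assumptions

variable {𝕏 V Ω : Type*} [MeasurableSpace 𝕏] [MeasurableSpace V] [MeasurableSpace Ω] {d n : ℕ}

/-- The random objects are measurable, and
(a) the attributes are independent across agents;
(b) given `X = x` the private types are independent, that of agent `i` with law `F x (x i)`;
(c) the shocks are i.i.d. logistic;
(d) the shocks are independent of attributes, private types and public signal. -/
structure Primitives (P : Measure Ω) (S : Sample 𝕏 V Ω n) (F : (Fin n → 𝕏) → 𝕏 → Measure ℝ) :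
    Prop where
  measurable_X : Measurable S.X
  measurable_A : Measurable S.A
  measurable_signal : Measurable S.signal
  measurable_shock : Measurable S.shock
  measurable_G : Measurable S.G
  indep_X : iIndepFun (fun (i : Fin n) ω => S.X ω i) P
  law_A : ∀ (x : Fin n → 𝕏) (s : Set (Fin n → ℝ)), MeasurableSet s →
    P {ω | S.X ω = x ∧ S.A ω ∈ s} = P {ω | S.X ω = x} * Measure.pi (fun i => F x (x i)) s
  law_shock : P.map S.shock = Measure.pi (fun _ => Measure.pi (fun _ => logistic))
  indep_shock : IndepFun S.shock (fun ω => (S.X ω, S.A ω, S.signal ω)) P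

/-- An equilibrium selection mechanism `lam` maps attributes and public signal measurably to a
symmetric equilibrium, and in the observed network every agent best-replies, given the private
type and the shocks, to the selected equilibrium. -/
structure EquilibriumSelection (P : Measure Ω) (S : Sample 𝕏 V Ω n)
    (F : (Fin n → 𝕏) → 𝕏 → Measure ℝ) (w : 𝕏 → 𝕏 → Fin d → ℝ) (β₀ : Param d)
    (lam : (Fin n → 𝕏) → V → Belief n) : Prop where
  measurable_lam : ∀ (x : Fin n → 𝕏) (i : Fin n) (g : Action i),
    Measurable (fun p : V × ℝ => lam x p.1 i p.2 g)
  equilibrium : ∀ᵐ ω ∂P,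
    IsEquilibrium w β₀ (S.X ω) (fun i => F (S.X ω) (S.X ω i)) (lam (S.X ω) (S.signal ω))
  symmetric : ∀ᵐ ω ∂P, IsSymmetric (S.X ω) (lam (S.X ω) (S.signal ω))
  best_reply : ∀ᵐ ω ∂P, ∀ (i : Fin n) (g : Action i),
    expectedPayoff w β₀ (S.X ω) (fun i => F (S.X ω) (S.X ω i)) (lam (S.X ω) (S.signal ω))
        i (S.A ω i) (S.shock ω i) g
      ≤ expectedPayoff w β₀ (S.X ω) (fun i => F (S.X ω) (S.X ω i)) (lam (S.X ω) (S.signal ω))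
        i (S.A ω i) (S.shock ω i) (S.G ω i)

/-- The expected log-likelihood `E[L_n(β, A, q) | X, A₀, σ*]` at `ω`, with `q` the link
probabilities of the selected equilibrium `σ* = lam X signal`; the conditional expectation is
taken with the regular conditional distribution of the network, so that it is defined for all
`(β, A)` at once. -/
def expectedLogLik (P : Measure Ω) [IsFiniteMeasure P] (S : Sample 𝕏 V Ω n)
    (F : (Fin n → 𝕏) → 𝕏 → Measure ℝ) (w : 𝕏 → 𝕏 → Fin d → ℝ)
    (lam : (Fin n → 𝕏) → V → Belief n) (ω : Ω) (β : Param d) (A : Fin n → ℝ) : ℝ :=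
  ∫ g, logLik w (S.X ω) g β A
      (meanLinkProb (fun i => F (S.X ω) (S.X ω i)) (lam (S.X ω) (S.signal ω)))
    ∂(condDistrib S.G (fun ω => (S.X ω, S.A ω, S.signal ω)) P (S.X ω, S.A ω, S.signal ω))

/-- `(β₀, A₀)` maximizes the expected log-likelihood at `ω` over `B × 𝔸ⁿ`, with a margin of at
least `η` over all points at distance at least `r`. Distance is measured as the log-likelihood
averages over agents: `‖β - β₀‖ + n⁻¹ ∑ i, |A i - A₀ i|`. -/
def SeparatedMaximum (P : Measure Ω) [IsFiniteMeasure P] (S : Sample 𝕏 V Ω n)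
    (F : (Fin n → 𝕏) → 𝕏 → Measure ℝ) (w : 𝕏 → 𝕏 → Fin d → ℝ)
    (lam : (Fin n → 𝕏) → V → Belief n) (B : Set (Param d)) (𝔸 : Set ℝ) (β₀ : Param d)
    (r η : ℝ) (ω : Ω) : Prop :=
  ∀ β ∈ B, ∀ A : Fin n → ℝ, (∀ i, A i ∈ 𝔸) →
    r ≤ ‖β - β₀‖ + (n : ℝ)⁻¹ * ∑ i, |A i - S.A ω i| →
      expectedLogLik P S F w lam ω β A + η ≤ expectedLogLik P S F w lam ω β₀ (S.A ω)

end Assumptions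

end

end NetFormation

/-!
Payoffs are linear in the links of the other agents, so in equilibrium agent `i` forms the link to
`j` exactly when its index, evaluated at the mean link probabilities `q`, plus the shock is
positive; ties have probability zero. Conditionally on attributes, types and signal the links are
therefore independent logit choices, and Hoeffding's inequality controls the sums of
`G i j - Q i j` over the agents of one attribute, by rows and by columns. Given the attributes, it
also controls the deviations of the choice probabilities of those agents, as functions of their
types, from their mean `q`; here a finite net of values of the index makes the bound uniform over
the random equilibrium. On the resulting event `q̂` is close to `q`, because by symmetry `q`
depends on attributes only, so `L_n(β, A, q̂)` is uniformly close to its conditional expectation at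
`q`, and the separated maximum forces `β̂` towards `β₀`. That argument controls the estimated types
only on average. For each of them, `Â i` maximizes the log-likelihood of row `i`, which is strongly
concave in the type uniformly in `i` and whose score at `A₀ i` is small.
-/

namespace NetFormation

/-! ### The logistic function and its primitive -/

/-- The primitive `z ↦ log (1 + exp z)` of the logistic function: the logit log-likelihood of a
link with index `z` is `z - softplus z`, that of no link is `-softplus z`. -/
noncomputable def softplus (z : ℝ) : ℝ := Real.log (1 + Real.exp z)

lemma one_sub_sigmoid (z : ℝ) : 1 - Real.sigmoid z = (1 + Real.exp z)⁻¹ := by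
  rw [← Real.sigmoid_neg, Real.sigmoid_def, neg_neg]

lemma sigmoid_eq_exp_div (z : ℝ) : Real.sigmoid z = Real.exp z / (1 + Real.exp z) := by
  rw [← sub_sub_self 1 (Real.sigmoid z), one_sub_sigmoid]
  field_simp
  ring

lemma log_one_sub_sigmoid (z : ℝ) : Real.log (1 - Real.sigmoid z) = -softplus z := by
  rw [one_sub_sigmoid, Real.log_inv, softplus]

lemma log_sigmoid (z : ℝ) : Real.log (Real.sigmoid z) = z - softplus z := by
  rw [sigmoid_eq_exp_div, Real.log_div (Real.exp_pos z).ne' (by positivity), Real.log_exp, softplus]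

lemma hasDerivAt_softplus (z : ℝ) : HasDerivAt softplus (Real.sigmoid z) z := by
  rw [sigmoid_eq_exp_div]
  exact ((Real.hasDerivAt_exp z).const_add 1).log (by positivity)

lemma lipschitzWith_softplus : LipschitzWith 1 softplus :=
  lipschitzWith_of_nnnorm_deriv_le (fun z => (hasDerivAt_softplus z).differentiableAt) fun z => by
    rw [(hasDerivAt_softplus z).deriv, ← NNReal.coe_le_coe, coe_nnnorm,
      Real.norm_of_nonneg (Real.sigmoid_nonneg z)]
    exact Real.sigmoid_le_one z

lemma lipschitzWith_sigmoid : LipschitzWith 1 Real.sigmoid :=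
  lipschitzWith_of_nnnorm_deriv_le differentiable_sigmoid fun z => by
    have h0 := Real.sigmoid_nonneg z
    have h1 := sub_nonneg.2 (Real.sigmoid_le_one z)
    rw [(Real.hasDerivAt_sigmoid z).deriv, ← NNReal.coe_le_coe, coe_nnnorm,
      Real.norm_of_nonneg (mul_nonneg h0 h1)]
    exact mul_le_one₀ (Real.sigmoid_le_one z) h1 (by linarith)

lemma abs_softplus_sub_le (s t : ℝ) : |softplus s - softplus t| ≤ |s - t| := by
  simpa using lipschitzWith_softplus.norm_sub_le s t

lemma abs_sigmoid_sub_le (s t : ℝ) : |Real.sigmoid s - Real.sigmoid t| ≤ |s - t| := by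
  simpa using lipschitzWith_sigmoid.norm_sub_le s t

lemma abs_sub_sigmoid_le_one {p : ℝ} (hp : p ∈ Set.Icc (0 : ℝ) 1) (z : ℝ) :
    |p - Real.sigmoid z| ≤ 1 :=
  abs_sub_le_iff.2 ⟨by linarith [hp.2, Real.sigmoid_nonneg z],
    by linarith [hp.1, Real.sigmoid_le_one z]⟩

lemma add_deriv_mul_sub_add_sq_le {f f' : ℝ → ℝ} {s : Set ℝ} {c a b : ℝ} (hs : Convex ℝ s)
    (hf : ∀ z ∈ s, HasDerivAt f (f' z) z) (hf' : MonotoneOn (fun z => f' z - c * z) s)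
    (ha : a ∈ s) (hb : b ∈ s) :
    f a + f' a * (b - a) + c / 2 * (b - a) ^ 2 ≤ f b := by
  have hderiv : ∀ z ∈ s, HasDerivAt (fun z => f z - c / 2 * z ^ 2) (f' z - c * z) z := by
    intro z hz
    refine ((hf z hz).sub (((hasDerivAt_id z).pow 2).const_mul (c / 2))).congr_deriv ?_
    simp only [id_eq]
    ring
  have hcont : ContinuousOn (fun z => f z - c / 2 * z ^ 2) s :=
    fun z hz => (hderiv z hz).continuousAt.continuousWithinAt
  have tangent : (f' a - c * a) * (b - a) ≤ (f b - c / 2 * b ^ 2) - (f a - c / 2 * a ^ 2) := by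
    rcases lt_trichotomy a b with hab | rfl | hba
    · have hsub := hs.ordConnected.out ha hb
      obtain ⟨z, hz, hz'⟩ := exists_hasDerivAt_eq_slope _ _ hab (hcont.mono hsub)
        fun z hz => hderiv z (hsub (Set.Ioo_subset_Icc_self hz))
      have hmono := hf' ha (hsub (Set.Ioo_subset_Icc_self hz)) hz.1.le
      rw [eq_div_iff (sub_pos.2 hab).ne'] at hz'
      exact (mul_le_mul_of_nonneg_right hmono (sub_pos.2 hab).le).trans hz'.le
    · simp
    · have hsub := hs.ordConnected.out hb ha
      obtain ⟨z, hz, hz'⟩ := exists_hasDerivAt_eq_slope _ _ hba (hcont.mono hsub)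
        fun z hz => hderiv z (hsub (Set.Ioo_subset_Icc_self hz))
      have hmono := hf' (hsub (Set.Ioo_subset_Icc_self hz)) ha hz.2.le
      rw [eq_div_iff (sub_pos.2 hba).ne'] at hz'
      linarith [mul_le_mul_of_nonneg_right hmono (sub_pos.2 hba).le]
  linarith

/-- A lower bound for the derivative of the logistic function, hence for the second derivative of
`softplus`, on `[-M, M]`. -/
noncomputable def curvature (M : ℝ) : ℝ := Real.sigmoid (-M) ^ 2

lemma curvature_pos (M : ℝ) : 0 < curvature M := pow_pos (Real.sigmoid_pos _) 2

lemma curvature_le {M z : ℝ} (hz : z ∈ Set.Icc (-M) M) :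
    curvature M ≤ Real.sigmoid z * (1 - Real.sigmoid z) := by
  rw [curvature, sq, ← Real.sigmoid_neg]
  exact mul_le_mul (Real.sigmoid_le hz.1) (Real.sigmoid_le (neg_le_neg hz.2))
    (Real.sigmoid_nonneg _) (Real.sigmoid_nonneg _)

lemma monotoneOn_sigmoid_sub_curvature_mul (M : ℝ) :
    MonotoneOn (fun z => Real.sigmoid z - curvature M * z) (Set.Icc (-M) M) := by
  have hderiv : ∀ z, HasDerivAt (fun z => Real.sigmoid z - curvature M * z)
      (Real.sigmoid z * (1 - Real.sigmoid z) - curvature M) z := fun z => by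
    simpa using (Real.hasDerivAt_sigmoid z).fun_sub ((hasDerivAt_id z).const_mul (curvature M))
  exact monotoneOn_of_hasDerivWithinAt_nonneg (convex_Icc _ _)
    (fun z _ => (hderiv z).continuousAt.continuousWithinAt)
    (fun z _ => (hderiv z).hasDerivWithinAt)
    fun z hz => sub_nonneg.2 (curvature_le (interior_subset hz))

lemma softplus_add_sigmoid_mul_sub_add_sq_le {M s t : ℝ} (hs : |s| ≤ M) (ht : |t| ≤ M) :
    softplus s + Real.sigmoid s * (t - s) + curvature M / 2 * (t - s) ^ 2 ≤ softplus t :=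
  add_deriv_mul_sub_add_sq_le (convex_Icc _ _) (fun z _ => hasDerivAt_softplus z)
    (monotoneOn_sigmoid_sub_curvature_mul M) (abs_le.1 hs) (abs_le.1 ht)

/-! ### The logit log-likelihood -/

section LogitLikelihood

variable {ι : Type*} {s : Finset ι}

/-- The logit log-likelihood of the link probabilities (or links) `p` at the indices `z`. -/
noncomputable def logitLik (s : Finset ι) (p z : ι → ℝ) : ℝ := ∑ j ∈ s, (p j * z j - softplus (z j))

lemma logitLik_sub_logitLik (s : Finset ι) (p p' z : ι → ℝ) :
    logitLik s p z - logitLik s p' z = ∑ j ∈ s, (p j - p' j) * z j := by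
  rw [logitLik, logitLik, ← Finset.sum_sub_distrib]
  exact Finset.sum_congr rfl fun j _ => by ring

lemma abs_logitLik_sub_le {p : ι → ℝ} (hp : ∀ j, p j ∈ Set.Icc (0 : ℝ) 1) (z z' : ι → ℝ) :
    |logitLik s p z - logitLik s p z'| ≤ 2 * ∑ j ∈ s, |z j - z' j| := by
  rw [logitLik, logitLik, ← Finset.sum_sub_distrib, Finset.mul_sum]
  refine (Finset.abs_sum_le_sum_abs _ _).trans (Finset.sum_le_sum fun j _ => ?_)
  have hlin : |p j * (z j - z' j)| ≤ |z j - z' j| := by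
    rw [abs_mul, abs_of_nonneg (hp j).1]
    exact mul_le_of_le_one_left (abs_nonneg _) (hp j).2
  calc |p j * z j - softplus (z j) - (p j * z' j - softplus (z' j))|
      = |p j * (z j - z' j) - (softplus (z j) - softplus (z' j))| := by congr 1; ring
    _ ≤ |z j - z' j| + |z j - z' j| :=
        (abs_sub _ _).trans (add_le_add hlin (abs_softplus_sub_le _ _))
    _ = 2 * |z j - z' j| := by ring

lemma logitLik_add_le {M a a₀ : ℝ} (p y : ι → ℝ) (ha : ∀ j ∈ s, |y j + a| ≤ M)
    (ha₀ : ∀ j ∈ s, |y j + a₀| ≤ M) :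
    logitLik s p (fun j => y j + a) ≤ logitLik s p (fun j => y j + a₀)
      + (∑ j ∈ s, (p j - Real.sigmoid (y j + a₀))) * (a - a₀)
      - s.card * (curvature M / 2 * (a - a₀) ^ 2) := by
  calc logitLik s p (fun j => y j + a)
      ≤ ∑ j ∈ s, (p j * (y j + a₀) - softplus (y j + a₀)
        + (p j - Real.sigmoid (y j + a₀)) * (a - a₀) - curvature M / 2 * (a - a₀) ^ 2) := by
        refine Finset.sum_le_sum fun j hj => ?_
        have := softplus_add_sigmoid_mul_sub_add_sq_le (ha₀ j hj) (ha j hj)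
        rw [add_sub_add_left_eq_sub] at this
        linarith
    _ = _ := by
        rw [Finset.sum_sub_distrib, Finset.sum_add_distrib, ← Finset.sum_mul, Finset.sum_const,
          nsmul_eq_mul, logitLik]

lemma curvature_mul_card_mul_abs_sub_le_abs_score {M a a₀ : ℝ} (p y : ι → ℝ)
    (ha : ∀ j ∈ s, |y j + a| ≤ M) (ha₀ : ∀ j ∈ s, |y j + a₀| ≤ M)
    (hle : logitLik s p (fun j => y j + a₀) ≤ logitLik s p (fun j => y j + a)) :
    curvature M / 2 * (s.card * |a - a₀|) ≤ |∑ j ∈ s, (p j - Real.sigmoid (y j + a₀))| := by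
  rcases eq_or_ne a a₀ with rfl | hne
  · simp
  refine le_of_mul_le_mul_right ?_ (abs_pos.2 (sub_ne_zero.2 hne))
  calc curvature M / 2 * (s.card * |a - a₀|) * |a - a₀|
      = s.card * (curvature M / 2 * (a - a₀) ^ 2) := by rw [← sq_abs (a - a₀)]; ring
    _ ≤ (∑ j ∈ s, (p j - Real.sigmoid (y j + a₀))) * (a - a₀) := by
        linarith [logitLik_add_le p y ha ha₀]
    _ ≤ |∑ j ∈ s, (p j - Real.sigmoid (y j + a₀))| * |a - a₀| :=
        (le_abs_self _).trans (abs_mul _ _).le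

end LogitLikelihood

/-! ### The index and the log-likelihood -/

section Index

variable {𝕏 : Type*} {d n : ℕ} {q q' : Fin n → Fin n → ℝ} {i j : Fin n}

lemma link_mem_Icc (g : Network n) (i j : Fin n) : link g i j ∈ Set.Icc (0 : ℝ) 1 := by
  unfold link
  split_ifs <;> simp

lemma card_univ_erase (i : Fin n) : ((Finset.univ.erase i).card : ℝ) = n - 1 := by
  rw [Finset.cast_card_erase_of_mem (Finset.mem_univ i), Finset.card_univ, Fintype.card_fin]

lemma filter_ne_and_ne (i j : Fin n) :
    Finset.univ.filter (fun k => k ≠ i ∧ k ≠ j) = (Finset.univ.erase i).erase j := by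
  ext k
  simp [and_comm]

lemma card_filter_ne_and_ne (hij : i ≠ j) :
    ((Finset.univ.filter (fun k => k ≠ i ∧ k ≠ j)).card : ℝ) = n - 2 := by
  rw [filter_ne_and_ne, Finset.cast_card_erase_of_mem (by simp [hij.symm]), card_univ_erase]
  ring

lemma index_eq_add (w : 𝕏 → 𝕏 → Fin d → ℝ) (β : Param d) (x : Fin n → 𝕏)
    (q : Fin n → Fin n → ℝ) (a : ℝ) (i j : Fin n) :
    index w β x q a i j = index w β x q 0 i j + a := by
  unfold index
  ring

lemma popularity_mem_Icc (hq : ∀ i j, q i j ∈ Set.Icc (0 : ℝ) 1) (hij : i ≠ j) :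
    ((n : ℝ) - 2)⁻¹ * (∑ k ∈ Finset.univ.filter (fun k => k ≠ i ∧ k ≠ j), q j k)
      ∈ Set.Icc (0 : ℝ) 1 := by
  rw [← card_filter_ne_and_ne hij]
  refine ⟨mul_nonneg (by positivity) (Finset.sum_nonneg fun k _ => (hq j k).1),
    inv_mul_le_one_of_le₀ ?_ (Nat.cast_nonneg _)⟩
  simpa using Finset.sum_le_card_nsmul _ _ 1 fun k _ => (hq j k).2

/-- A Lipschitz constant of `index` in the parameter `β`, for link probabilities in `[0, 1]`. -/
noncomputable def indexLip [Fintype 𝕏] (w : 𝕏 → 𝕏 → Fin d → ℝ) : ℝ := d * ‖w‖ + 2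

lemma indexLip_pos [Fintype 𝕏] (w : 𝕏 → 𝕏 → Fin d → ℝ) : 0 < indexLip w := by
  unfold indexLip
  positivity

lemma abs_dotProduct_le [Fintype 𝕏] (w : 𝕏 → 𝕏 → Fin d → ℝ) (s t : 𝕏) (b : Fin d → ℝ) :
    |w s t ⬝ᵥ b| ≤ d * ‖w‖ * ‖b‖ := by
  have hw (l : Fin d) : |w s t l| ≤ ‖w‖ :=
    (norm_le_pi_norm (w s t) l).trans ((norm_le_pi_norm (w s) t).trans (norm_le_pi_norm w s))
  calc |w s t ⬝ᵥ b| ≤ ∑ l, |w s t l * b l| := Finset.abs_sum_le_sum_abs _ _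
    _ ≤ ∑ _l : Fin d, ‖w‖ * ‖b‖ := Finset.sum_le_sum fun l _ => by
        rw [abs_mul]
        exact mul_le_mul (hw l) (norm_le_pi_norm b l) (abs_nonneg _) (norm_nonneg _)
    _ = d * ‖w‖ * ‖b‖ := by simp [mul_assoc]

lemma abs_index_sub_index_le [Fintype 𝕏] (w : 𝕏 → 𝕏 → Fin d → ℝ)
    (hq : ∀ i j, q i j ∈ Set.Icc (0 : ℝ) 1) (hij : i ≠ j) (x : Fin n → 𝕏) (β β' : Param d)
    (a : ℝ) :
    |index w β x q a i j - index w β' x q a i j| ≤ indexLip w * ‖β - β'‖ := by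
  have hsplit : index w β x q a i j - index w β' x q a i j
      = w (x i) (x j) ⬝ᵥ (β - β').1 + q j i * (β - β').2.1
        + ((n : ℝ) - 2)⁻¹ * (∑ k ∈ Finset.univ.filter (fun k => k ≠ i ∧ k ≠ j), q j k)
          * (β - β').2.2 := by
    simp only [index, Prod.fst_sub, Prod.snd_sub, dotProduct_sub]
    ring
  have unit_mul {p c : ℝ} (hp : p ∈ Set.Icc (0 : ℝ) 1) : |p * c| ≤ |c| := by
    rw [abs_mul, abs_of_nonneg hp.1]
    exact mul_le_of_le_one_left (abs_nonneg _) hp.2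
  have homophily := (abs_dotProduct_le w (x i) (x j) (β - β').1).trans
    (mul_le_mul_of_nonneg_left (norm_fst_le (β - β')) (by positivity))
  have reciprocity := (unit_mul (c := (β - β').2.1) (hq j i)).trans
    ((norm_fst_le (β - β').2).trans (norm_snd_le _))
  have popularity := (unit_mul (c := (β - β').2.2) (popularity_mem_Icc hq hij)).trans
    ((norm_snd_le (β - β').2).trans (norm_snd_le _))
  rw [hsplit, indexLip]
  refine (abs_add_three _ _ _).trans ?_
  linarith

lemma abs_index_le [Fintype 𝕏] (w : 𝕏 → 𝕏 → Fin d → ℝ) (hq : ∀ i j, q i j ∈ Set.Icc (0 : ℝ) 1)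
    (hij : i ≠ j) (x : Fin n → 𝕏) (β : Param d) (a : ℝ) :
    |index w β x q a i j| ≤ indexLip w * ‖β‖ + |a| := by
  have hzero : index w 0 x q a i j = a := by simp [index]
  have hdiff := abs_index_sub_index_le w hq hij x β 0 a
  rw [hzero, sub_zero] at hdiff
  linarith [abs_sub_abs_le_abs_sub (index w β x q a i j) a]

lemma abs_index_sub_index_le_sum (w : 𝕏 → 𝕏 → Fin d → ℝ) (hn : 2 < n) (q q' : Fin n → Fin n → ℝ)
    (x : Fin n → 𝕏) (β : Param d) (a : ℝ) (i j : Fin n) :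
    |index w β x q' a i j - index w β x q a i j|
      ≤ ‖β‖ * (|q' j i - q j i|
        + ((n : ℝ) - 2)⁻¹ * ∑ k ∈ Finset.univ.erase j, |q' j k - q j k|) := by
  have hn' : 0 ≤ ((n : ℝ) - 2)⁻¹ := inv_nonneg.2 (sub_nonneg.2 (by exact_mod_cast hn.le))
  have hsplit : index w β x q' a i j - index w β x q a i j = β.2.1 * (q' j i - q j i)
      + β.2.2 * (((n : ℝ) - 2)⁻¹ *
        ∑ k ∈ Finset.univ.filter (fun k => k ≠ i ∧ k ≠ j), (q' j k - q j k)) := by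
    simp only [index, Finset.sum_sub_distrib]
    ring
  have hsum : |∑ k ∈ Finset.univ.filter (fun k => k ≠ i ∧ k ≠ j), (q' j k - q j k)|
      ≤ ∑ k ∈ Finset.univ.erase j, |q' j k - q j k| := by
    refine (Finset.abs_sum_le_sum_abs _ _).trans
      (Finset.sum_le_sum_of_subset_of_nonneg ?_ fun _ _ _ => abs_nonneg _)
    rw [filter_ne_and_ne]
    exact Finset.erase_subset_erase _ (Finset.subset_univ _)
  rw [hsplit, mul_add]
  refine (abs_add_le _ _).trans (add_le_add ?_ ?_)
  · rw [abs_mul]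
    exact mul_le_mul_of_nonneg_right ((norm_fst_le β.2).trans (norm_snd_le β)) (abs_nonneg _)
  · rw [abs_mul, abs_mul, abs_of_nonneg hn']
    exact mul_le_mul ((norm_snd_le β.2).trans (norm_snd_le β))
      (mul_le_mul_of_nonneg_left hsum hn') (by positivity) (norm_nonneg _)

lemma sum_sum_erase_comm (f : Fin n → Fin n → ℝ) :
    ∑ j, ∑ k ∈ Finset.univ.erase j, f j k = ∑ k, ∑ j ∈ Finset.univ.erase k, f j k :=
  Finset.sum_comm' fun j k => by simp [eq_comm]

lemma sum_abs_index_sub_index_le (w : 𝕏 → 𝕏 → Fin d → ℝ) {K : ℝ}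
    (hK : ∀ l, ∑ k ∈ Finset.univ.erase l, |q' k l - q k l| ≤ K) (hn : 3 ≤ n)
    (x : Fin n → 𝕏) (β : Param d) (a : ℝ) (i : Fin n) :
    ∑ j ∈ Finset.univ.erase i, |index w β x q' a i j - index w β x q a i j| ≤ 4 * K * ‖β‖ := by
  have hn3 : (3 : ℝ) ≤ n := by exact_mod_cast hn
  have hn' : 0 < (n : ℝ) - 2 := by linarith
  have hK0 : 0 ≤ K := (Finset.sum_nonneg fun _ _ => abs_nonneg _).trans (hK i)
  have htotal : ∑ j ∈ Finset.univ.erase i, ∑ k ∈ Finset.univ.erase j, |q' j k - q j k| ≤ n * K :=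
    calc _ ≤ ∑ j, ∑ k ∈ Finset.univ.erase j, |q' j k - q j k| :=
          Finset.sum_le_sum_of_subset_of_nonneg (Finset.subset_univ _)
            fun _ _ _ => Finset.sum_nonneg fun _ _ => abs_nonneg _
      _ = ∑ k, ∑ j ∈ Finset.univ.erase k, |q' j k - q j k| := sum_sum_erase_comm _
      _ ≤ ∑ _k : Fin n, K := Finset.sum_le_sum fun k _ => hK k
      _ = n * K := by simp
  calc _ ≤ ∑ j ∈ Finset.univ.erase i, ‖β‖ * (|q' j i - q j i|
          + ((n : ℝ) - 2)⁻¹ * ∑ k ∈ Finset.univ.erase j, |q' j k - q j k|) :=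
        Finset.sum_le_sum fun j _ => abs_index_sub_index_le_sum w hn q q' x β a i j
    _ = ‖β‖ * (∑ j ∈ Finset.univ.erase i, |q' j i - q j i| + ((n : ℝ) - 2)⁻¹
          * ∑ j ∈ Finset.univ.erase i, ∑ k ∈ Finset.univ.erase j, |q' j k - q j k|) := by
        rw [← Finset.mul_sum, Finset.sum_add_distrib, ← Finset.mul_sum]
    _ ≤ ‖β‖ * (K + ((n : ℝ) - 2)⁻¹ * (n * K)) := by gcongr; exact hK i
    _ ≤ ‖β‖ * (K + 3 * K) := by
        have : ((n : ℝ) - 2)⁻¹ * (n * K) ≤ 3 * K := by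
          rw [inv_mul_le_iff₀ hn']
          nlinarith
        gcongr
    _ = 4 * K * ‖β‖ := by ring

/-- The normalized logit log-likelihood of all links, with link probabilities (or links) `p` and
indices `z`. -/
noncomputable def networkLik (p z : Fin n → Fin n → ℝ) : ℝ :=
  ((n : ℝ) * ((n : ℝ) - 1))⁻¹ * ∑ i, logitLik (Finset.univ.erase i) (p i) (z i)

lemma logLik_eq_networkLik (w : 𝕏 → 𝕏 → Fin d → ℝ) (x : Fin n → 𝕏) (g : Network n) (β : Param d)
    (A : Fin n → ℝ) (q : Fin n → Fin n → ℝ) :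
    logLik w x g β A q = networkLik (link g) (fun i => index w β x q (A i) i) := by
  unfold logLik networkLik logitLik choiceProb
  congr 1
  refine Finset.sum_congr rfl fun i _ => Finset.sum_congr rfl fun j _ => ?_
  rw [log_sigmoid, log_one_sub_sigmoid]
  ring

lemma abs_networkLik_sub_le {p p' z z' : Fin n → Fin n → ℝ} {b : ℝ} (hn : 0 < n)
    (h : ∀ i, |logitLik (Finset.univ.erase i) (p i) (z i)
      - logitLik (Finset.univ.erase i) (p' i) (z' i)| ≤ b) :
    |networkLik p z - networkLik p' z'| ≤ ((n : ℝ) - 1)⁻¹ * b := by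
  have hn1 : 0 ≤ ((n : ℝ) - 1)⁻¹ := inv_nonneg.2 (sub_nonneg.2 (by exact_mod_cast hn))
  have hn0 : (n : ℝ) ≠ 0 := by exact_mod_cast hn.ne'
  rw [networkLik, networkLik, ← mul_sub, ← Finset.sum_sub_distrib, mul_inv, abs_mul, abs_mul,
    abs_of_nonneg hn1, abs_of_nonneg (by positivity)]
  calc _ ≤ (n : ℝ)⁻¹ * ((n : ℝ) - 1)⁻¹ * ∑ _i : Fin n, b := by
        gcongr
        exact (Finset.abs_sum_le_sum_abs _ _).trans (Finset.sum_le_sum fun i _ => h i)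
    _ = ((n : ℝ) - 1)⁻¹ * b := by
        rw [Finset.sum_const, Finset.card_univ, Fintype.card_fin, nsmul_eq_mul]
        field_simp

end Index

/-! ### Dependence on attributes only -/

section Attributes

variable {𝕏 : Type*} {d n : ℕ} {x : Fin n → 𝕏} {q : Fin n → Fin n → ℝ}

/-- The off-diagonal entries of `q` depend only on the attributes of the two agents. -/
def IsAttributeFunction (x : Fin n → 𝕏) (q : Fin n → Fin n → ℝ) : Prop :=
  ∀ i j k l, i ≠ j → k ≠ l → x i = x k → x j = x l → q i j = q k l

lemma IsAttributeFunction.exists_eq (h : IsAttributeFunction x q) :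
    ∃ f : 𝕏 → 𝕏 → ℝ, ∀ i j, i ≠ j → q i j = f (x i) (x j) := by
  let pairs := {p : Fin n × Fin n // p.1 ≠ p.2}
  let attributes (p : pairs) : 𝕏 × 𝕏 := (x p.1.1, x p.1.2)
  have hfactors : Function.FactorsThrough (fun p : pairs => q p.1.1 p.1.2) attributes :=
    fun p p' hp => h _ _ _ _ p.2 p'.2 (congrArg Prod.fst hp) (congrArg Prod.snd hp)
  exact ⟨fun s t => Function.extend attributes (fun p => q p.1.1 p.1.2) 0 (s, t),
    fun i j hij => (hfactors.extend_apply 0 ⟨(i, j), hij⟩).symm⟩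

lemma IsAttributeFunction.index (h : IsAttributeFunction x q) (w : 𝕏 → 𝕏 → Fin d → ℝ)
    (β : Param d) (a : ℝ) : IsAttributeFunction x (index w β x q a) := by
  obtain ⟨f, hf⟩ := h.exists_eq
  have hsum : ∀ i j, i ≠ j → ∑ m ∈ Finset.univ.filter (fun m => m ≠ i ∧ m ≠ j), q j m
      = ∑ m, f (x j) (x m) - f (x j) (x i) - f (x j) (x j) := by
    intro i j hij
    rw [filter_ne_and_ne, ← Finset.sum_erase_eq_sub (Finset.mem_univ i),
      ← Finset.sum_erase_eq_sub (by simp [hij.symm])]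
    exact Finset.sum_congr rfl fun m hm => hf j m (Finset.ne_of_mem_erase hm).symm
  intro i j k l hij hkl hik hjl
  unfold NetFormation.index
  rw [hsum i j hij, hsum k l hkl, hf j i hij.symm, hf l k hkl.symm, hik, hjl]

variable [DecidableEq 𝕏]

/-- The agents other than `j` whose attribute is `s`. -/
def others (x : Fin n → 𝕏) (s : 𝕏) (j : Fin n) : Finset (Fin n) :=
  (Finset.univ.erase j).filter (fun k => x k = s)

lemma mem_others {s : 𝕏} {j k : Fin n} : k ∈ others x s j ↔ k ≠ j ∧ x k = s := by
  simp [others]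

lemma sum_sum_others [Fintype 𝕏] (x : Fin n → 𝕏) (j : Fin n) (f : Fin n → ℝ) :
    ∑ s, ∑ k ∈ others x s j, f k = ∑ k ∈ Finset.univ.erase j, f k :=
  Finset.sum_fiberwise _ x f

lemma others_eq_erase (x : Fin n → 𝕏) (s : 𝕏) (j : Fin n) :
    others x s j = (Finset.univ.filter (fun k => x k = s)).erase j :=
  Finset.filter_erase _ _ _

lemma card_others_congr (s : 𝕏) {j l : Fin n} (h : x j = x l) :
    (others x s j).card = (others x s l).card := by
  simp only [others_eq_erase, Finset.card_erase_eq_ite, Finset.mem_filter, Finset.mem_univ,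
    true_and, h]

lemma abs_sum_others_le {s : 𝕏} {f : Fin n → ℝ} {b c : ℝ} (hc : 0 ≤ c) (hfc : ∀ k, |f k| ≤ c)
    (h : |∑ k with x k = s, f k| ≤ b) (j : Fin n) : |∑ k ∈ others x s j, f k| ≤ b + c := by
  by_cases hj : x j = s
  · rw [others_eq_erase, Finset.sum_erase_eq_sub (by simp [hj])]
    exact (abs_sub _ _).trans (add_le_add h (hfc j))
  · rw [others_eq_erase, Finset.erase_eq_of_notMem (by simp [hj])]
    linarith

lemma abs_sum_mul_le_of_abs_sum_others_le [Fintype 𝕏] {f z : Fin n → ℝ} {M b : ℝ} {j : Fin n}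
    (hM : 0 ≤ M) (hz : ∀ k ≠ j, ∀ l ≠ j, x k = x l → z k = z l) (hzM : ∀ k ≠ j, |z k| ≤ M)
    (hf : ∀ s, |∑ k ∈ others x s j, f k| ≤ b) :
    |∑ k ∈ Finset.univ.erase j, f k * z k| ≤ Fintype.card 𝕏 * (M * b) := by
  rw [← sum_sum_others x, ← nsmul_eq_mul]
  refine (Finset.abs_sum_le_sum_abs _ _).trans (Finset.sum_le_card_nsmul _ _ _ fun s _ => ?_)
  rcases Finset.eq_empty_or_nonempty (others x s j) with hempty | ⟨k₀, hk₀⟩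
  · rw [hempty, Finset.sum_empty, abs_zero]
    exact mul_nonneg hM ((abs_nonneg _).trans (hf s))
  rw [mem_others] at hk₀
  have hconst : ∑ k ∈ others x s j, f k * z k = z k₀ * ∑ k ∈ others x s j, f k := by
    rw [Finset.mul_sum]
    refine Finset.sum_congr rfl fun k hk => ?_
    rw [mem_others] at hk
    rw [hz k hk.1 k₀ hk₀.1 (hk.2.trans hk₀.2.symm), mul_comm]
  rw [hconst, abs_mul]
  exact mul_le_mul (hzM k₀ hk₀.1) (hf s) (abs_nonneg _) hM

end Attributes

/-! ### The first-step estimates -/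

section FirstStep

variable {𝕏 : Type*} [DecidableEq 𝕏] {n : ℕ} {x : Fin n → 𝕏} {g : Network n}

lemma sum_pairs_eq_sum_others (x : Fin n → 𝕏) (s t : 𝕏) (f : Fin n → Fin n → ℝ) :
    (∑ i, ∑ j ∈ Finset.univ.erase i, if x i = s ∧ x j = t then f i j else 0)
      = ∑ j with x j = t, ∑ i ∈ others x s j, f i j := by
  rw [sum_sum_erase_comm, Finset.sum_filter]
  refine Finset.sum_congr rfl fun j _ => ?_
  split_ifs with h <;> simp [others, Finset.sum_filter, h]

lemma frequency_eq_div (x : Fin n → 𝕏) (g : Network n) (s t : 𝕏) :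
    frequency x g s t = (∑ j with x j = t, ∑ i ∈ others x s j, link g i j)
      / ∑ j with x j = t, ((others x s j).card : ℝ) := by
  rw [frequency, sum_pairs_eq_sum_others, sum_pairs_eq_sum_others x s t fun _ _ => 1]
  simp only [Finset.sum_const, nsmul_eq_mul, mul_one]

lemma frequency_mem_Icc (x : Fin n → 𝕏) (g : Network n) (s t : 𝕏) :
    frequency x g s t ∈ Set.Icc (0 : ℝ) 1 := by
  rw [frequency_eq_div]
  refine ⟨div_nonneg (Finset.sum_nonneg fun j _ => Finset.sum_nonneg fun i _ =>
    (link_mem_Icc g i j).1) (by positivity), div_le_one_of_le₀ ?_ (by positivity)⟩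
  refine Finset.sum_le_sum fun j _ => ?_
  simpa using Finset.sum_le_card_nsmul _ _ 1 fun i _ => (link_mem_Icc g i j).2

lemma card_others_mul_abs_frequency_sub_le {s : 𝕏} {l : Fin n} {p b : ℝ}
    (hcol : ∀ j, x j = x l → |∑ k ∈ others x s j, (link g k j - p)| ≤ b) :
    (others x s l).card * |frequency x g s (x l) - p| ≤ b := by
  rcases (others x s l).card.eq_zero_or_pos with hzero | hpos
  · simpa [hzero] using (abs_nonneg _).trans (hcol l rfl)
  set T := Finset.univ.filter (fun j => x j = x l)
  set m : ℝ := ((others x s l).card : ℝ)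
  have hm : 0 < m := Nat.cast_pos.2 hpos
  have hT : 0 < (T.card : ℝ) := Nat.cast_pos.2 (Finset.card_pos.2 ⟨l, by simp [T]⟩)
  have hcard : ∀ j ∈ T, ((others x s j).card : ℝ) = m := fun j hj =>
    congrArg Nat.cast (card_others_congr s (Finset.mem_filter.1 hj).2)
  have hden : ∑ j ∈ T, ((others x s j).card : ℝ) = T.card * m := by
    rw [Finset.sum_congr rfl hcard, Finset.sum_const, nsmul_eq_mul]
  have hfreq : frequency x g s (x l)
      = (∑ j ∈ T, ∑ k ∈ others x s j, link g k j) / (T.card * m) := by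
    rw [frequency_eq_div, hden]
  have hnum : ∑ j ∈ T, ∑ k ∈ others x s j, (link g k j - p)
      = T.card * (m * (frequency x g s (x l) - p)) := by
    simp only [Finset.sum_sub_distrib, Finset.sum_const, nsmul_eq_mul]
    rw [← Finset.sum_mul, hden, hfreq]
    field_simp
  refine le_of_mul_le_mul_left ?_ hT
  calc T.card * (m * |frequency x g s (x l) - p|)
      = |∑ j ∈ T, ∑ k ∈ others x s j, (link g k j - p)| := by
        rw [hnum, abs_mul, abs_mul, abs_of_pos hT, abs_of_pos hm]
    _ ≤ T.card • b := (Finset.abs_sum_le_sum_abs _ _).trans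
        (Finset.sum_le_card_nsmul _ _ _ fun j hj => hcol j (Finset.mem_filter.1 hj).2)
    _ = T.card * b := nsmul_eq_mul _ _

lemma sum_abs_qHat_sub_le [Fintype 𝕏] {q : Fin n → Fin n → ℝ} {b : ℝ} (hb : 0 ≤ b)
    (hq : IsAttributeFunction x q) (l : Fin n)
    (hcol : ∀ k ≠ l, ∀ j, x j = x l → |∑ i ∈ others x (x k) j, (link g i j - q k l)| ≤ b) :
    ∑ k ∈ Finset.univ.erase l, |qHat x g k l - q k l| ≤ Fintype.card 𝕏 * b := by
  rw [← sum_sum_others x, ← nsmul_eq_mul]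
  refine Finset.sum_le_card_nsmul _ _ _ fun s _ => ?_
  rcases Finset.eq_empty_or_nonempty (others x s l) with hempty | ⟨k₀, hk₀⟩
  · simpa [hempty] using hb
  obtain ⟨hk₀l, rfl⟩ := mem_others.1 hk₀
  calc ∑ k ∈ others x (x k₀) l, |qHat x g k l - q k l|
      = ∑ _k ∈ others x (x k₀) l, |frequency x g (x k₀) (x l) - q k₀ l| := by
        refine Finset.sum_congr rfl fun _ hk => ?_
        rw [mem_others] at hk
        rw [qHat, hk.2, hq _ l k₀ l hk.1 hk₀l hk.2 rfl]
    _ = (others x (x k₀) l).card * |frequency x g (x k₀) (x l) - q k₀ l| := by simp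
    _ ≤ b := card_others_mul_abs_frequency_sub_le (hcol k₀ hk₀l)

end FirstStep

/-! ### Typical realizations -/

section Typical

variable {𝕏 : Type*} [DecidableEq 𝕏] {d n : ℕ}

/-- A realization in which the laws of large numbers hold up to `ε`: those for the links around
their conditional choice probabilities, by columns and by rows, and those for the choice
probabilities as functions of the private types around `q`. -/
structure IsTypical (w : 𝕏 → 𝕏 → Fin d → ℝ) (β₀ : Param d) (x : Fin n → 𝕏) (A₀ : Fin n → ℝ)
    (g : Network n) (q : Fin n → Fin n → ℝ) (ε : ℝ) : Prop where
  mem_Icc : ∀ i j, q i j ∈ Set.Icc (0 : ℝ) 1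
  isAttributeFunction : IsAttributeFunction x q
  column : ∀ j s, |∑ i ∈ others x s j, (link g i j - choiceProb w β₀ x q (A₀ i) i j)| ≤ ε * n
  row : ∀ i t, |∑ j ∈ others x t i, (link g i j - choiceProb w β₀ x q (A₀ i) i j)| ≤ ε * n
  type : ∀ i j, i ≠ j →
    |∑ k with x k = x i, (choiceProb w β₀ x q (A₀ k) i j - q i j)| ≤ ε * n

lemma IsTwoStepMLE.logitLik_le {w : 𝕏 → 𝕏 → Fin d → ℝ} {B : Set (Param d)} {𝔸 : Set ℝ}
    {x : Fin n → 𝕏} {g : Network n} {β : Param d} {A : Fin n → ℝ}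
    (h : IsTwoStepMLE w B 𝔸 x g β A) (hn : 1 < n) (i : Fin n) {a : ℝ} (ha : a ∈ 𝔸) :
    logitLik (Finset.univ.erase i) (link g i) (index w β x (qHat x g) a i)
      ≤ logitLik (Finset.univ.erase i) (link g i) (index w β x (qHat x g) (A i) i) := by
  obtain ⟨hβ, hA, hmax⟩ := h
  have hn1 : 0 < (n : ℝ) - 1 := sub_pos.2 (by exact_mod_cast hn)
  have hupdate : ∀ k, Function.update A i a k ∈ 𝔸 := fun k => by
    rcases eq_or_ne k i with rfl | hk
    · simpa using ha
    · simpa [hk] using hA k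
  have hle := hmax β hβ _ hupdate
  rw [logLik_eq_networkLik, logLik_eq_networkLik, networkLik, networkLik,
    mul_le_mul_iff_right₀ (inv_pos.2 (mul_pos (by linarith) hn1)),
    ← Finset.add_sum_erase _ _ (Finset.mem_univ i),
    ← Finset.add_sum_erase (a := i) _ (fun k => logitLik _ (link g k)
      (index w β x (qHat x g) (A k) k)) (Finset.mem_univ i),
    Finset.sum_congr rfl fun k hk => by
      rw [Function.update_of_ne (Finset.ne_of_mem_erase hk)]] at hle
  simpa using le_of_add_le_add_right hle

variable [Fintype 𝕏] {w : 𝕏 → 𝕏 → Fin d → ℝ} {β₀ : Param d} {x : Fin n → 𝕏} {A₀ : Fin n → ℝ}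
  {g : Network n} {q : Fin n → Fin n → ℝ} {ε R RA : ℝ}

namespace IsTypical

lemma sum_abs_qHat_sub_le (h : IsTypical w β₀ x A₀ g q ε) (hεn : 1 ≤ ε * n) (l : Fin n) :
    ∑ k ∈ Finset.univ.erase l, |qHat x g k l - q k l| ≤ Fintype.card 𝕏 * (3 * (ε * n)) := by
  refine NetFormation.sum_abs_qHat_sub_le (by linarith) h.isAttributeFunction l
    fun k hkl j hj => ?_
  have hsplit : ∑ i ∈ others x (x k) j, (link g i j - q k l)
      = ∑ i ∈ others x (x k) j, (link g i j - choiceProb w β₀ x q (A₀ i) i j)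
        + ∑ i ∈ others x (x k) j, (choiceProb w β₀ x q (A₀ i) k l - q k l) := by
    rw [← Finset.sum_add_distrib]
    refine Finset.sum_congr rfl fun i hi => ?_
    rw [mem_others] at hi
    rw [choiceProb, choiceProb,
      h.isAttributeFunction.index w β₀ (A₀ i) i j k l hi.1 hkl hi.2 hj]
    ring
  have htype := abs_sum_others_le zero_le_one
    (fun i => abs_sub_comm (q k l) _ ▸ abs_sub_sigmoid_le_one (h.mem_Icc k l) _)
    (h.type k l hkl) j
  rw [hsplit]
  refine (abs_add_le _ _).trans ?_
  exact (add_le_add (h.column j (x k)) htype).trans (by linarith)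

lemma sum_abs_index_qHat_sub_le (h : IsTypical w β₀ x A₀ g q ε) (hn : 3 ≤ n) (hεn : 1 ≤ ε * n)
    {β : Param d} (hβ : ‖β‖ ≤ R) (a : ℝ) (i : Fin n) :
    ∑ j ∈ Finset.univ.erase i, |index w β x (qHat x g) a i j - index w β x q a i j|
      ≤ Fintype.card 𝕏 * (12 * R) * (ε * n) := by
  calc _ ≤ 4 * (Fintype.card 𝕏 * (3 * (ε * n))) * ‖β‖ :=
        sum_abs_index_sub_index_le w (h.sum_abs_qHat_sub_le hεn) hn x β a i
    _ ≤ 4 * (Fintype.card 𝕏 * (3 * (ε * n))) * R := by gcongr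
    _ = _ := by ring

lemma abs_sum_row_mul_index_le (h : IsTypical w β₀ x A₀ g q ε) {β : Param d} {a : ℝ}
    (hβ : ‖β‖ ≤ R) (ha : |a| ≤ RA) (i : Fin n) :
    |∑ j ∈ Finset.univ.erase i,
        (link g i j - choiceProb w β₀ x q (A₀ i) i j) * index w β x q a i j|
      ≤ Fintype.card 𝕏 * ((indexLip w * R + RA) * (ε * n)) := by
  have hL := (indexLip_pos w).le
  have hR : 0 ≤ R := (norm_nonneg β).trans hβ
  have hRA : 0 ≤ RA := (abs_nonneg a).trans ha
  refine abs_sum_mul_le_of_abs_sum_others_le (by positivity) (fun j hj k hk hjk =>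
    h.isAttributeFunction.index w β a i j i k hj.symm hk.symm rfl hjk) (fun j hj => ?_) (h.row i)
  exact (abs_index_le w h.mem_Icc hj.symm x β a).trans (by gcongr)

lemma abs_logLik_sub_le (h : IsTypical w β₀ x A₀ g q ε) (hn : 3 ≤ n) (hεn : 1 ≤ ε * n)
    {β : Param d} (hβ : ‖β‖ ≤ R) {A : Fin n → ℝ} (hA : ∀ i, |A i| ≤ RA) :
    |logLik w x g β A (qHat x g)
        - networkLik (fun i => choiceProb w β₀ x q (A₀ i) i) (fun i => index w β x q (A i) i)|
      ≤ Fintype.card 𝕏 * (48 * R + 2 * (indexLip w * R + RA)) * ε := by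
  set N : ℝ := (Fintype.card 𝕏 : ℝ)
  set M : ℝ := indexLip w * R + RA
  have hn3 : (3 : ℝ) ≤ n := by exact_mod_cast hn
  have hε : 0 ≤ ε := nonneg_of_mul_nonneg_left (by linarith) (by linarith : (0 : ℝ) < n)
  have hM : 0 ≤ 24 * R + M := by
    have hL := indexLip_pos w
    have hR : 0 ≤ R := (norm_nonneg β).trans hβ
    have hRA : 0 ≤ RA := (abs_nonneg _).trans (hA ⟨0, by lia⟩)
    positivity
  have hrow : ∀ i, |logitLik (Finset.univ.erase i) (link g i) (index w β x (qHat x g) (A i) i)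
      - logitLik (Finset.univ.erase i) (choiceProb w β₀ x q (A₀ i) i) (index w β x q (A i) i)|
      ≤ N * (24 * R + M) * (ε * n) := fun i => by
    refine (abs_sub_le _ (logitLik (Finset.univ.erase i) (link g i)
      (index w β x q (A i) i)) _).trans ?_
    have hindex := h.sum_abs_index_qHat_sub_le hn hεn hβ (A i) i
    have hlink := h.abs_sum_row_mul_index_le hβ (hA i) i
    rw [← logitLik_sub_logitLik] at hlink
    linarith [NetFormation.abs_logitLik_sub_le (s := Finset.univ.erase i) (link_mem_Icc g i)
      (index w β x (qHat x g) (A i) i) (index w β x q (A i) i)]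
  rw [logLik_eq_networkLik]
  refine (abs_networkLik_sub_le (by lia) hrow).trans ?_
  rw [inv_mul_le_iff₀ (by linarith)]
  calc N * (24 * R + M) * (ε * n) ≤ N * (24 * R + M) * (ε * (2 * (n - 1))) := by
        gcongr
        linarith
    _ = _ := by ring

lemma abs_score_le (h : IsTypical w β₀ x A₀ g q ε) (hn : 3 ≤ n) (hεn : 1 ≤ ε * n) {β : Param d}
    (hβ : ‖β‖ ≤ R) (i : Fin n) :
    |∑ j ∈ Finset.univ.erase i,
        (link g i j - Real.sigmoid (index w β x (qHat x g) (A₀ i) i j))|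
      ≤ Fintype.card 𝕏 * (1 + 12 * R) * (ε * n) + (n - 1) * (indexLip w * ‖β - β₀‖) := by
  have hlinks : |∑ j ∈ Finset.univ.erase i, (link g i j - choiceProb w β₀ x q (A₀ i) i j)|
      ≤ Fintype.card 𝕏 * (1 * (ε * n)) := by
    simpa using abs_sum_mul_le_of_abs_sum_others_le (z := fun _ => 1) zero_le_one
      (fun _ _ _ _ _ => rfl) (fun _ _ => by simp) (h.row i)
  have hprobs : ∀ j ∈ Finset.univ.erase i,
      |choiceProb w β₀ x q (A₀ i) i j - Real.sigmoid (index w β x (qHat x g) (A₀ i) i j)|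
        ≤ indexLip w * ‖β - β₀‖
          + |index w β x (qHat x g) (A₀ i) i j - index w β x q (A₀ i) i j| := fun j hj => by
    rw [abs_sub_comm]
    refine (abs_sigmoid_sub_le _ _).trans
      ((abs_sub_le _ (index w β x q (A₀ i) i j) _).trans ?_)
    linarith [abs_index_sub_index_le w h.mem_Icc (Finset.ne_of_mem_erase hj).symm x β β₀ (A₀ i)]
  have hprobs_sum := (Finset.abs_sum_le_sum_abs _ _).trans (Finset.sum_le_sum hprobs)
  rw [Finset.sum_add_distrib, Finset.sum_const, nsmul_eq_mul, card_univ_erase] at hprobs_sum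
  have hsplit : ∑ j ∈ Finset.univ.erase i,
        (link g i j - Real.sigmoid (index w β x (qHat x g) (A₀ i) i j))
      = ∑ j ∈ Finset.univ.erase i, (link g i j - choiceProb w β₀ x q (A₀ i) i j)
        + ∑ j ∈ Finset.univ.erase i, (choiceProb w β₀ x q (A₀ i) i j
          - Real.sigmoid (index w β x (qHat x g) (A₀ i) i j)) := by
    rw [← Finset.sum_add_distrib]
    exact Finset.sum_congr rfl fun j _ => by ring
  rw [hsplit]
  refine (abs_add_le _ _).trans ?_
  linarith [h.sum_abs_index_qHat_sub_le hn hεn hβ (A₀ i) i]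

lemma curvature_mul_abs_type_sub_le (h : IsTypical w β₀ x A₀ g q ε) (hn : 3 ≤ n)
    (hεn : 1 ≤ ε * n) {B : Set (Param d)} {𝔸 : Set ℝ} (hB : ∀ β ∈ B, ‖β‖ ≤ R)
    (h𝔸 : ∀ a ∈ 𝔸, |a| ≤ RA) (hA₀ : ∀ i, A₀ i ∈ 𝔸) {β : Param d} {A : Fin n → ℝ}
    (hmle : IsTwoStepMLE w B 𝔸 x g β A) (i : Fin n) :
    curvature (indexLip w * R + RA) / 2 * |A i - A₀ i|
      ≤ Fintype.card 𝕏 * (2 + 24 * R) * ε + indexLip w * ‖β - β₀‖ := by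
  have hn3 : (3 : ℝ) ≤ n := by exact_mod_cast hn
  have hn1 : 0 < (n : ℝ) - 1 := by linarith
  have hε : 0 ≤ ε := nonneg_of_mul_nonneg_left (by linarith) (by linarith : (0 : ℝ) < n)
  have hβ := hB β hmle.1
  have hR : 0 ≤ R := (norm_nonneg β).trans hβ
  obtain ⟨y, hy⟩ : ∃ y : Fin n → ℝ, ∀ a, index w β x (qHat x g) a i = fun j => y j + a :=
    ⟨_, fun a => funext (index_eq_add w β x (qHat x g) a i)⟩
  have hbound : ∀ a ∈ 𝔸, ∀ j ∈ Finset.univ.erase i,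
      |y j + a| ≤ indexLip w * R + RA := fun a ha j hj => by
    rw [← congrFun (hy a) j]
    exact (abs_index_le w (fun k l => frequency_mem_Icc x g _ _) (Finset.ne_of_mem_erase hj).symm
      x β a).trans (add_le_add (mul_le_mul_of_nonneg_left hβ (indexLip_pos w).le) (h𝔸 a ha))
  have hopt := hmle.logitLik_le (by lia) i (hA₀ i)
  have hscore := h.abs_score_le hn hεn hβ i
  simp only [hy] at hopt hscore
  have hcurv := (curvature_mul_card_mul_abs_sub_le_abs_score (link g i) _
    (hbound _ (hmle.2.1 i)) (hbound _ (hA₀ i)) hopt).trans hscore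
  rw [card_univ_erase] at hcurv
  refine le_of_mul_le_mul_left ?_ hn1
  calc (n - 1) * (curvature (indexLip w * R + RA) / 2 * |A i - A₀ i|)
      ≤ Fintype.card 𝕏 * (1 + 12 * R) * (ε * n) + (n - 1) * (indexLip w * ‖β - β₀‖) := by linarith
    _ ≤ Fintype.card 𝕏 * (1 + 12 * R) * (ε * (2 * (n - 1)))
        + (n - 1) * (indexLip w * ‖β - β₀‖) := by
        gcongr
        linarith
    _ = _ := by ring

end IsTypical

end Typical

/-! ### The logistic distribution -/

lemma logistic_Iic (t : ℝ) : logistic (Set.Iic t) = ENNReal.ofReal (Real.sigmoid t) := by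
  have h := logisticCDF.measure_Iic Real.tendsto_sigmoid_atBot t
  rwa [sub_zero] at h

lemma logistic_Ioi (t : ℝ) : logistic (Set.Ioi t) = ENNReal.ofReal (Real.sigmoid (-t)) := by
  rw [Real.sigmoid_neg]
  exact logisticCDF.measure_Ioi Real.tendsto_sigmoid_atTop t

lemma logistic_singleton (t : ℝ) : logistic {t} = 0 := by
  have hleft : Function.leftLim logisticCDF t = logisticCDF t :=
    ContinuousWithinAt.leftLim_eq (f := Real.sigmoid) continuous_sigmoid.continuousWithinAt
  have h := logisticCDF.measure_singleton t
  rwa [hleft, sub_self, ENNReal.ofReal_zero] at h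

lemma logistic_real_pos_add (v : ℝ) : logistic.real {t | 0 < v + t} = Real.sigmoid v := by
  have h : {t : ℝ | 0 < v + t} = Set.Ioi (-v) := Set.ext fun t => by
    rw [Set.mem_ofPred_eq, Set.mem_Ioi, neg_lt_iff_pos_add']
  rw [h, measureReal_def, logistic_Ioi, neg_neg, ENNReal.toReal_ofReal (Real.sigmoid_nonneg _)]

lemma logistic_real_add_neg_le (v : ℝ) : logistic.real {t | v + t < 0} ≤ 1 - Real.sigmoid v := by
  have h : {t : ℝ | v + t < 0} ⊆ Set.Iic (-v) := fun t ht => by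
    rw [Set.mem_Iic]
    exact (lt_neg_iff_add_neg'.2 ht).le
  refine (measureReal_mono h).trans_eq ?_
  rw [measureReal_def, logistic_Iic, ENNReal.toReal_ofReal (Real.sigmoid_nonneg _),
    Real.sigmoid_neg]

lemma pi_logistic_real_eval {ι : Type*} [Fintype ι] {s : Set ℝ} (hs : MeasurableSet s) (j : ι) :
    (Measure.pi (fun _ : ι => logistic)).real {e | e j ∈ s} = logistic.real s :=
  (measurePreserving_eval (fun _ : ι => logistic) j).measureReal_preimage hs.nullMeasurableSet

/-! ### Linear payoffs and best replies -/

section LinearPayoff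

variable {n : ℕ} {i j : Fin n}

/-- The payoff of the action `g` if every proposed link `j` is worth `v j`. -/
def linearPayoff (v : Fin n → ℝ) (g : Action i) : ℝ :=
  ∑ j, if g.1 j = true then v j else 0

/-- The action `g` with the proposal to `j` replaced by `b`. -/
def Action.set (g : Action i) (hij : i ≠ j) (b : Bool) : Action i :=
  ⟨Function.update g.1 j b, by rw [Function.update_of_ne hij]; exact g.2⟩

lemma linearPayoff_set (v : Fin n → ℝ) (g : Action i) (hij : i ≠ j) (b : Bool) :
    linearPayoff v (g.set hij b)
      = linearPayoff v g
        + ((if b = true then v j else 0) - if g.1 j = true then v j else 0) := by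
  have hrest : ∀ k ∈ Finset.univ.erase j,
      (if (g.set hij b).1 k = true then v k else 0) = if g.1 k = true then v k else 0 :=
    fun k hk => by simp [Action.set, Finset.ne_of_mem_erase hk]
  rw [linearPayoff, linearPayoff, ← Finset.add_sum_erase _ _ (Finset.mem_univ j),
    ← Finset.add_sum_erase _ (fun k => if g.1 k = true then v k else 0) (Finset.mem_univ j),
    Finset.sum_congr rfl hrest, show (g.set hij b).1 j = b from Function.update_self ..]
  ring

lemma measurable_linearPayoff (v : Fin n → ℝ) (g : Action i) :
    Measurable (fun e : Fin n → ℝ => linearPayoff (v + e) g) := by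
  refine Finset.measurable_sum _ fun j _ => ?_
  split_ifs <;> fun_prop

lemma link_eq_of_best_reply {v : Fin n → ℝ} {g : Network n} (hij : i ≠ j)
    (hbr : ∀ g' : Action i, linearPayoff v g' ≤ linearPayoff v (g i)) (hv : v j ≠ 0) :
    link g i j = if 0 < v j then 1 else 0 := by
  have hdrop := hbr ((g i).set hij false)
  have hpropose := hbr ((g i).set hij true)
  rw [linearPayoff_set] at hdrop hpropose
  unfold link
  cases hg : (g i).1 j <;> simp only [hg] at hdrop hpropose ⊢ <;> grind

/-- The shocks for which `g` is the unique best reply if the link `j` is worth `v j` before its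
shock. -/
def uniqueBestReply (v : Fin n → ℝ) (g : Action i) : Set (Fin n → ℝ) :=
  {e | ∀ g', g' ≠ g → linearPayoff (v + e) g' < linearPayoff (v + e) g}

lemma measurableSet_uniqueBestReply (v : Fin n → ℝ) (g : Action i) :
    MeasurableSet (uniqueBestReply v g) := by
  simp only [uniqueBestReply, Set.ofPred_forall]
  exact MeasurableSet.iInter fun g' => MeasurableSet.iInter fun _ =>
    measurableSet_lt (measurable_linearPayoff v g') (measurable_linearPayoff v g)

lemma pairwise_disjoint_uniqueBestReply (v : Fin n → ℝ) :
    Pairwise (Function.onFun Disjoint (uniqueBestReply (i := i) v)) :=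
  fun _ _ hne => Set.disjoint_left.2 fun _ he he' => lt_asymm (he _ hne.symm) (he' _ hne)

lemma uniqueBestReply_subset (v : Fin n → ℝ) (hij : i ≠ j) (g : Action i) :
    uniqueBestReply v g ⊆ {e | if g.1 j = true then 0 < v j + e j else v j + e j < 0} := by
  intro e he
  have hne : g.set hij (!g.1 j) ≠ g := fun heq => by
    simpa [Action.set] using congrFun (congrArg Subtype.val heq) j
  have hlt := he _ hne
  rw [linearPayoff_set] at hlt
  cases hg : g.1 j <;> simp [hg] at hlt ⊢ <;> linarith

lemma sum_pi_logistic_uniqueBestReply_le (v : Fin n → ℝ) (hij : i ≠ j) (b : Bool) :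
    ∑ g : Action i with g.1 j = b,
        (Measure.pi (fun _ : Fin n => logistic)).real (uniqueBestReply v g)
      ≤ if b = true then Real.sigmoid (v j) else 1 - Real.sigmoid (v j) := by
  set s : Set ℝ := {t | if b = true then 0 < v j + t else v j + t < 0} with hs
  have hsm : MeasurableSet s := by
    cases b
    · simpa [hs] using measurableSet_lt (by fun_prop) (by fun_prop)
    · simpa [hs] using measurableSet_lt (by fun_prop) (by fun_prop)
  have hsub : (⋃ g ∈ Finset.univ.filter fun g : Action i => g.1 j = b, uniqueBestReply v g)
      ⊆ {e | e j ∈ s} := Set.iUnion₂_subset fun g hg => by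
    have h := uniqueBestReply_subset v hij g
    rwa [(Finset.mem_filter.1 hg).2] at h
  rw [← measureReal_biUnion_finset (fun _ _ _ _ hne => pairwise_disjoint_uniqueBestReply v hne)
    fun g _ => measurableSet_uniqueBestReply v g]
  refine (measureReal_mono hsub).trans ?_
  rw [pi_logistic_real_eval hsm]
  cases b
  · simpa [hs] using logistic_real_add_neg_le (v j)
  · simpa [hs] using (logistic_real_pos_add (v j)).le

end LinearPayoff

/-! ### Expected payoffs and equilibrium link probabilities -/

lemma sum_prod_mul_eval {ι : Type*} [Fintype ι] [DecidableEq ι] {κ : ι → Type*}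
    [∀ i, Fintype (κ i)] {m : (i : ι) → κ i → ℝ} {j : ι} (hm : ∀ l ≠ j, ∑ h, m l h = 1)
    (φ : κ j → ℝ) : ∑ g : (i : ι) → κ i, (∏ l, m l (g l)) * φ (g j) = ∑ h, m j h * φ h := by
  have hprod : ∀ g : (i : ι) → κ i, (∏ l, m l (g l)) * φ (g j)
      = ∏ l, Function.update m j (fun h => m j h * φ h) l (g l) := fun g => by
    rw [← Finset.mul_prod_erase _ _ (Finset.mem_univ j),
      ← Finset.mul_prod_erase _ (fun l => Function.update m j _ l (g l)) (Finset.mem_univ j),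
      Function.update_self, mul_right_comm]
    congr 1
    exact Finset.prod_congr rfl fun l hl => by
      rw [Function.update_of_ne (Finset.ne_of_mem_erase hl)]
  rw [Finset.sum_congr rfl fun g _ => hprod g, ← Fintype.piFinset_univ, ← Finset.prod_univ_sum,
    Finset.prod_eq_single j (fun l _ hl => by rw [Function.update_of_ne hl, hm l hl]) (by simp),
    Function.update_self]

section Game

variable {𝕏 : Type*} {d n : ℕ} {w : 𝕏 → 𝕏 → Fin d → ℝ} {β : Param d} {x : Fin n → 𝕏}
  {μA : Fin n → Measure ℝ} {σ : Belief n}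

lemma payoff_eq_linearPayoff (w : 𝕏 → 𝕏 → Fin d → ℝ) (β : Param d) (x : Fin n → 𝕏) (i : Fin n)
    (a : ℝ) (e : Fin n → ℝ) (g : Network n) :
    payoff w β x i a e g = linearPayoff (index w β x (link g) a i + e) (g i) := by
  simp only [payoff, linearPayoff, link, ite_mul, one_mul, zero_mul, Pi.add_apply]

lemma sum_mul_index {ι : Type*} [Fintype ι] {c : ι → ℝ} (hc : ∑ t, c t = 1)
    (w : 𝕏 → 𝕏 → Fin d → ℝ) (β : Param d) (x : Fin n → 𝕏) {m : ι → Fin n → Fin n → ℝ}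
    {q : Fin n → Fin n → ℝ} {j : Fin n} (hq : ∀ k, ∑ t, c t * m t j k = q j k) (a : ℝ)
    (i : Fin n) : ∑ t, c t * index w β x (m t) a i j = index w β x q a i j := by
  have hsum : ∑ k ∈ Finset.univ.filter (fun k => k ≠ i ∧ k ≠ j), q j k
      = ∑ t, c t * ∑ k ∈ Finset.univ.filter (fun k => k ≠ i ∧ k ≠ j), m t j k := by
    simp only [← hq, Finset.mul_sum]
    exact Finset.sum_comm
  unfold index
  rw [hsum, ← hq i]
  conv_rhs => rw [← one_mul (w (x i) (x j) ⬝ᵥ β.1 + a), ← hc]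
  simp only [Finset.sum_mul, Finset.mul_sum, ← Finset.sum_add_distrib]
  refine Finset.sum_congr rfl fun t _ => ?_
  simp only [← Finset.mul_sum, ← Finset.sum_mul]
  ring

/-- The probabilities of the actions of each agent `j`, in the eyes of an agent `i` who plays
`gi`. -/
noncomputable def actionProb (μA : Fin n → Measure ℝ) (σ : Belief n) {i : Fin n} (gi : Action i) :
    (j : Fin n) → Action j → ℝ :=
  Function.update (fun j g => ∫ t, σ j t g ∂(μA j)) i (Pi.single gi 1)

lemma actionProb_of_ne {i j : Fin n} (gi : Action i) (hj : j ≠ i) :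
    actionProb μA σ gi j = fun g => ∫ t, σ j t g ∂(μA j) :=
  Function.update_of_ne hj _ _

lemma expectedPayoff_eq_sum (w : 𝕏 → 𝕏 → Fin d → ℝ) (β : Param d) (x : Fin n → 𝕏)
    (μA : Fin n → Measure ℝ) (σ : Belief n) (i : Fin n) (a : ℝ) (e : Fin n → ℝ) (gi : Action i) :
    expectedPayoff w β x μA σ i a e gi
      = ∑ g : Network n, (∏ j, actionProb μA σ gi j (g j))
          * linearPayoff (index w β x (link g) a i + e) gi := by
  refine Finset.sum_congr rfl fun g _ => ?_
  rw [← Finset.mul_prod_erase _ _ (Finset.mem_univ i), Finset.prod_congr rfl fun j hj =>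
    congrFun (actionProb_of_ne gi (Finset.ne_of_mem_erase hj)) (g j), payoff_eq_linearPayoff,
    actionProb, Function.update_self, Pi.single_apply]
  split_ifs with hg
  · rw [hg, one_mul]
  · rw [zero_mul, zero_mul]

namespace IsEquilibrium

lemma mem_Icc (h : IsEquilibrium w β x μA σ) (i : Fin n) (a : ℝ) (g : Action i) :
    σ i a g ∈ Set.Icc (0 : ℝ) 1 :=
  ⟨(h.1 i a).1 g, (h.1 i a).2 ▸
    Finset.single_le_sum (fun g _ => (h.1 i a).1 g) (Finset.mem_univ g)⟩

lemma integrable [∀ j, IsProbabilityMeasure (μA j)] (h : IsEquilibrium w β x μA σ)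
    (hσ : ∀ i g, Measurable (fun a => σ i a g)) (i : Fin n) (g : Action i) :
    Integrable (fun a => σ i a g) (μA i) :=
  Integrable.of_mem_Icc 0 1 (hσ i g).aemeasurable (ae_of_all _ fun a => h.mem_Icc i a g)

lemma sum_integral [∀ j, IsProbabilityMeasure (μA j)] (h : IsEquilibrium w β x μA σ)
    (hσ : ∀ i g, Measurable (fun a => σ i a g)) (i : Fin n) :
    ∑ g, ∫ a, σ i a g ∂(μA i) = 1 := by
  rw [← integral_finsetSum _ fun g _ => h.integrable hσ i g]
  simp [(h.1 i _).2]

lemma meanLinkProb_eq_sum [∀ j, IsProbabilityMeasure (μA j)] (h : IsEquilibrium w β x μA σ)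
    (hσ : ∀ i g, Measurable (fun a => σ i a g)) (i j : Fin n) :
    meanLinkProb μA σ i j
      = ∑ g : Action i, (∫ a, σ i a g ∂(μA i)) * if g.1 j = true then 1 else 0 := by
  simp only [meanLinkProb, linkProb, mul_ite, mul_one, mul_zero, ← Finset.sum_filter]
  exact integral_finsetSum _ fun g _ => h.integrable hσ i g

lemma sum_actionProb [∀ j, IsProbabilityMeasure (μA j)] (h : IsEquilibrium w β x μA σ)
    (hσ : ∀ i g, Measurable (fun a => σ i a g)) {i : Fin n} (gi : Action i) (j : Fin n) :
    ∑ g, actionProb μA σ gi j g = 1 := by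
  rcases eq_or_ne j i with rfl | hj
  · simp [actionProb]
  · rw [actionProb_of_ne gi hj, h.sum_integral hσ j]

lemma sum_prod_actionProb_mul_link [∀ j, IsProbabilityMeasure (μA j)]
    (h : IsEquilibrium w β x μA σ) (hσ : ∀ i g, Measurable (fun a => σ i a g)) {i j : Fin n}
    (gi : Action i) (hj : j ≠ i) (k : Fin n) :
    ∑ g : Network n, (∏ l, actionProb μA σ gi l (g l)) * link g j k = meanLinkProb μA σ j k := by
  rw [h.meanLinkProb_eq_sum hσ]
  refine (sum_prod_mul_eval (fun l _ => h.sum_actionProb hσ gi l)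
    (fun g : Action j => if g.1 k = true then (1 : ℝ) else 0)).trans ?_
  rw [actionProb_of_ne gi hj]

lemma expectedPayoff_eq [∀ j, IsProbabilityMeasure (μA j)] (h : IsEquilibrium w β x μA σ)
    (hσ : ∀ i g, Measurable (fun a => σ i a g)) (i : Fin n) (a : ℝ) (e : Fin n → ℝ)
    (gi : Action i) :
    expectedPayoff w β x μA σ i a e gi
      = linearPayoff (index w β x (meanLinkProb μA σ) a i + e) gi := by
  have hsum : ∑ g : Network n, ∏ j, actionProb μA σ gi j (g j) = 1 := by
    simpa [h.sum_actionProb hσ gi] using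
      sum_prod_mul_eval (j := i) (fun l _ => h.sum_actionProb hσ gi l) 1
  simp only [expectedPayoff_eq_sum, linearPayoff, Finset.mul_sum]
  rw [Finset.sum_comm]
  refine Finset.sum_congr rfl fun j _ => ?_
  split_ifs with hj
  · have hji : j ≠ i := fun hji => by simp [hji, gi.2] at hj
    simp only [Pi.add_apply, mul_add, Finset.sum_add_distrib, ← Finset.sum_mul, hsum, one_mul]
    rw [sum_mul_index hsum w β x (h.sum_prod_actionProb_mul_link hσ gi hji)]
  · simp

lemma linkProb_eq [∀ j, IsProbabilityMeasure (μA j)] (h : IsEquilibrium w β x μA σ)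
    (hσ : ∀ i g, Measurable (fun a => σ i a g)) {i j : Fin n} (hij : i ≠ j) (a : ℝ) :
    linkProb σ i j a = choiceProb w β x (meanLinkProb μA σ) a i j := by
  set v : Fin n → ℝ := index w β x (meanLinkProb μA σ) a i
  have hσ_eq : ∀ g, σ i a g
      = (Measure.pi (fun _ : Fin n => logistic)).real (uniqueBestReply v g) := fun g => by
    simp only [h.2 i a g, h.expectedPayoff_eq hσ]
    rfl
  have hpropose := sum_pi_logistic_uniqueBestReply_le v hij true
  have hdrop := sum_pi_logistic_uniqueBestReply_le v hij false
  have htotal := Finset.sum_filter_add_sum_filter_not Finset.univ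
    (fun g : Action i => g.1 j = true) (σ i a)
  simp only [← hσ_eq, if_true, Bool.false_eq_true, if_false, Bool.not_eq_true, (h.1 i a).2]
    at hpropose hdrop htotal
  rw [linkProb, ← Finset.sum_filter, choiceProb]
  linarith

lemma meanLinkProb_mem_Icc [∀ j, IsProbabilityMeasure (μA j)] (h : IsEquilibrium w β x μA σ)
    (hσ : ∀ i g, Measurable (fun a => σ i a g)) (i j : Fin n) :
    meanLinkProb μA σ i j ∈ Set.Icc (0 : ℝ) 1 := by
  have hnn : ∀ g, 0 ≤ ∫ a, σ i a g ∂(μA i) := fun g =>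
    integral_nonneg fun a => (h.mem_Icc i a g).1
  have hind : ∀ g : Action i, (if g.1 j = true then (1 : ℝ) else 0) ∈ Set.Icc (0 : ℝ) 1 :=
    fun g => by split_ifs <;> simp
  rw [h.meanLinkProb_eq_sum hσ]
  constructor
  · exact Finset.sum_nonneg fun g _ => mul_nonneg (hnn g) (hind g).1
  · exact (Finset.sum_le_sum fun g _ => mul_le_of_le_one_right (hnn g) (hind g).2).trans_eq
      (h.sum_integral hσ i)

lemma integral_choiceProb [∀ j, IsProbabilityMeasure (μA j)] (h : IsEquilibrium w β x μA σ)
    (hσ : ∀ i g, Measurable (fun a => σ i a g)) {i j : Fin n} (hij : i ≠ j) :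
    ∫ a, choiceProb w β x (meanLinkProb μA σ) a i j ∂(μA i) = meanLinkProb μA σ i j :=
  integral_congr_ae (ae_of_all _ fun a => (h.linkProb_eq hσ hij a).symm)

end IsEquilibrium

lemma IsSymmetric.isAttributeFunction {μ : 𝕏 → Measure ℝ} (h : IsSymmetric x σ) :
    IsAttributeFunction x (meanLinkProb (fun i => μ (x i)) σ) := fun i j k l hij hkl hik hjl => by
  simp only [meanLinkProb, hik]
  exact integral_congr_ae (ae_of_all _ (h i j k l hij hkl hik hjl))

end Game

/-! ### Concentration -/

section Concentration

variable {Ω : Type*} [MeasurableSpace Ω] {P : Measure Ω} [IsProbabilityMeasure P]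

lemma measureReal_abs_ge_le {X : Ω → ℝ} {c : NNReal} (h : HasSubgaussianMGF X c P) {ε : ℝ}
    (hε : 0 ≤ ε) : P.real {ω | ε ≤ |X ω|} ≤ 2 * Real.exp (-ε ^ 2 / (2 * c)) := by
  have hsplit : {ω | ε ≤ |X ω|} ⊆ {ω | ε ≤ X ω} ∪ {ω | ε ≤ (-X) ω} := fun ω hω => by
    rw [Set.mem_union, Set.mem_ofPred_eq, Set.mem_ofPred_eq, Pi.neg_apply]
    exact le_abs.1 hω
  rw [two_mul]
  exact ((measureReal_mono hsplit).trans (measureReal_union_le _ _)).trans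
    (add_le_add (h.measure_ge_le hε) (h.neg.measure_ge_le hε))

lemma measureReal_abs_sum_ge_le {ι : Type*} {X : ι → Ω → ℝ} {s : Finset ι} {m : ℕ} {ε : ℝ}
    (hindep : iIndepFun X P) (hmeas : ∀ i ∈ s, AEMeasurable (X i) P)
    (hmem : ∀ i ∈ s, ∀ ω, X i ω ∈ Set.Icc (-1 : ℝ) 1) (hmean : ∀ i ∈ s, ∫ ω, X i ω ∂P = 0)
    (hs : s.card ≤ m) (hε : 0 ≤ ε) :
    P.real {ω | ε * m ≤ |∑ i ∈ s, X i ω|} ≤ 2 * Real.exp (-(ε ^ 2 * m / 2)) := by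
  have hsub : ∀ i ∈ s, HasSubgaussianMGF (X i) 1 P := fun i hi => by
    have h := hasSubgaussianMGF_of_mem_Icc_of_integral_eq_zero (hmeas i hi)
      (ae_of_all _ (hmem i hi)) (hmean i hi)
    convert h using 1
    ext
    norm_num
  have hsum := HasSubgaussianMGF.sum_of_iIndepFun hindep hsub
  have hsum_m : HasSubgaussianMGF (fun ω => ∑ i ∈ s, X i ω) (m : NNReal) P := by
    refine ⟨hsum.integrable_exp_mul, fun t => (hsum.mgf_le t).trans (Real.exp_le_exp.2 ?_)⟩
    gcongr
    simpa using hs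
  refine (measureReal_abs_ge_le hsum_m (mul_nonneg hε m.cast_nonneg)).trans_eq ?_
  rcases eq_or_ne m 0 with rfl | hm
  · simp
  · congr 2
    rw [NNReal.coe_natCast]
    field_simp

/-- Hoeffding's bound for the probability that at most `n` independent centered variables with
values in `[-1, 1]` have a sum of absolute value at least `ε * n`. -/
noncomputable def hoeffdingTail (ε : ℝ) (n : ℕ) : ENNReal :=
  ENNReal.ofReal (2 * Real.exp (-(ε ^ 2 * n / 2)))

lemma tendsto_pow_mul_hoeffdingTail (k : ℕ) {ε : ℝ} (hε : 0 < ε) :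
    Tendsto (fun n : ℕ => (n : ENNReal) ^ k * hoeffdingTail ε n) atTop (𝓝 0) := by
  have hdecay := (tendsto_pow_const_mul_const_pow_of_lt_one k (Real.exp_pos (-(ε ^ 2 / 2))).le
    (Real.exp_lt_one_iff.2 (neg_lt_zero.2 (by positivity)))).const_mul 2
  rw [mul_zero] at hdecay
  refine (ENNReal.ofReal_zero ▸ ENNReal.tendsto_ofReal hdecay).congr fun n => ?_
  rw [hoeffdingTail, ← ENNReal.ofReal_natCast, ← ENNReal.ofReal_pow n.cast_nonneg,
    ← ENNReal.ofReal_mul (by positivity), ← Real.exp_nat_mul, mul_left_comm]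
  congr 5
  ring

lemma measurable_sum_of_measurableSet_mem {α ι : Type*} [MeasurableSpace α] [Finite ι]
    {s : α → Finset ι} (hs : ∀ k, MeasurableSet {a | k ∈ s a}) {f : ι → α → ℝ}
    (hf : ∀ k, Measurable (f k)) : Measurable fun a => ∑ k ∈ s a, f k a := by
  classical
  cases nonempty_fintype ι
  have hsum : ∀ a, ∑ k ∈ s a, f k a = ∑ k, if k ∈ s a then f k a else 0 := fun a => by
    rw [Finset.sum_ite_mem, Finset.univ_inter]
  simp only [hsum]
  exact Finset.measurable_sum _ fun k _ => Measurable.ite (hs k) (hf k) measurable_const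

lemma measure_le_of_indepFun {𝒴 ℰ : Type*} [MeasurableSpace 𝒴] [MeasurableSpace ℰ]
    {Y : Ω → 𝒴} {e : Ω → ℰ} (hY : Measurable Y) (he : Measurable e) (hind : IndepFun e Y P)
    {s : Set (𝒴 × ℰ)} (hs : MeasurableSet s) {b : ENNReal}
    (hb : ∀ y, P.map e {t | (y, t) ∈ s} ≤ b) : P {ω | (Y ω, e ω) ∈ s} ≤ b := by
  have : IsProbabilityMeasure (P.map Y) := Measure.isProbabilityMeasure_map hY.aemeasurable
  have : IsProbabilityMeasure (P.map e) := Measure.isProbabilityMeasure_map he.aemeasurable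
  calc P {ω | (Y ω, e ω) ∈ s} = ((P.map Y).prod (P.map e)) s := by
        rw [← (indepFun_iff_map_prod_eq_prod_map_map hY.aemeasurable he.aemeasurable).1 hind.symm,
          Measure.map_apply (hY.prodMk he) hs]
        rfl
    _ = ∫⁻ y, P.map e {t | (y, t) ∈ s} ∂(P.map Y) := Measure.prod_apply hs
    _ ≤ ∫⁻ _, b ∂(P.map Y) := lintegral_mono hb
    _ = b := by simp

end Concentration

section Shocks

/-- The law of the matrix of shocks. -/
noncomputable abbrev shockLaw (n : ℕ) : Measure (Fin n → Fin n → ℝ) :=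
  Measure.pi fun _ => Measure.pi fun _ => logistic

variable {n : ℕ}

lemma measurePreserving_shock (i j : Fin n) :
    MeasurePreserving (fun e : Fin n → Fin n → ℝ => e i j) (shockLaw n) logistic :=
  (measurePreserving_eval (fun _ : Fin n => logistic) j).comp
    (measurePreserving_eval (fun _ : Fin n => Measure.pi fun _ : Fin n => logistic) i)

lemma integral_shock {f : ℝ → ℝ} (hf : Measurable f) (i j : Fin n) :
    ∫ e, f (e i j) ∂shockLaw n = ∫ t, f t ∂logistic := by
  rw [← (measurePreserving_shock i j).map_eq,
    integral_map (measurePreserving_shock i j).measurable.aemeasurable hf.aestronglyMeasurable]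

lemma iIndepFun_shock :
    iIndepFun (fun (p : Fin n × Fin n) (e : Fin n → Fin n → ℝ) => e p.1 p.2) (shockLaw n) := by
  refine iIndepFun_uncurry' (X := fun i j (e : Fin n → Fin n → ℝ) => e i j)
    (fun i j => by fun_prop)
    (iIndepFun_pi (X := fun _ => id) fun _ => aemeasurable_id) fun i => ?_
  rw [iIndepFun_iff_map_fun_eq_pi_map
    fun j => (measurePreserving_shock i j).measurable.aemeasurable]
  simp only [(measurePreserving_shock i _).map_eq]
  exact (measurePreserving_eval (fun _ : Fin n => Measure.pi fun _ : Fin n => logistic) i).map_eq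

/-- The indicator that a link of index `v` is formed under the shock `t`, minus its
probability. -/
noncomputable def centeredLink (v t : ℝ) : ℝ := (if 0 < v + t then 1 else 0) - Real.sigmoid v

lemma measurableSet_pos_add (v : ℝ) : MeasurableSet {t : ℝ | 0 < v + t} :=
  measurableSet_lt measurable_const (measurable_const_add v)

lemma measurable_centeredLink : Measurable (fun p : ℝ × ℝ => centeredLink p.1 p.2) :=
  (Measurable.ite (measurableSet_lt measurable_const (measurable_fst.add measurable_snd))
    measurable_const measurable_const).sub (continuous_sigmoid.measurable.comp measurable_fst)

lemma centeredLink_mem_Icc (v t : ℝ) : centeredLink v t ∈ Set.Icc (-1 : ℝ) 1 := by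
  have h0 := Real.sigmoid_nonneg v
  have h1 := Real.sigmoid_le_one v
  unfold centeredLink
  split_ifs <;> constructor <;> linarith

lemma integral_pos_add (v : ℝ) :
    ∫ t, (if 0 < v + t then (1 : ℝ) else 0) ∂logistic = Real.sigmoid v := by
  have h : (fun t => if 0 < v + t then (1 : ℝ) else 0) = Set.indicator {t : ℝ | 0 < v + t} 1 :=
    funext fun t => by simp [Set.indicator_apply]
  rw [h, integral_indicator_one (measurableSet_pos_add v), logistic_real_pos_add]

lemma integral_centeredLink (v : ℝ) : ∫ t, centeredLink v t ∂logistic = 0 := by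
  have hint : Integrable (fun t => if 0 < v + t then (1 : ℝ) else 0) logistic :=
    Integrable.of_mem_Icc 0 1
      (Measurable.ite (measurableSet_pos_add v) measurable_const measurable_const).aemeasurable
      (ae_of_all _ fun t => by split_ifs <;> simp)
  simp only [centeredLink]
  rw [integral_sub hint (integrable_const _), integral_pos_add, integral_const, probReal_univ,
    one_smul, sub_self]

lemma shockLaw_real_abs_sum_centeredLink_ge_le {τ : Fin n → Fin n × Fin n}
    (hτ : Function.Injective τ) (v : Fin n → ℝ) (s : Finset (Fin n)) {ε : ℝ} (hε : 0 ≤ ε) :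
    (shockLaw n).real {e | ε * n ≤ |∑ k ∈ s, centeredLink (v k) (e (τ k).1 (τ k).2)|}
      ≤ 2 * Real.exp (-(ε ^ 2 * n / 2)) := by
  have hmeas : ∀ k, Measurable (centeredLink (v k)) := fun k =>
    measurable_centeredLink.comp measurable_prodMk_left
  refine measureReal_abs_sum_ge_le ((iIndepFun_shock.precomp hτ).comp _ hmeas)
    (fun k _ => ((hmeas k).comp (by fun_prop)).aemeasurable)
    (fun k _ e => centeredLink_mem_Icc _ _) (fun k _ => ?_)
    ((Finset.card_le_univ s).trans_eq (Fintype.card_fin n)) hε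
  exact (integral_shock (hmeas k) _ _).trans (integral_centeredLink (v k))

variable {Ω 𝒴 : Type*} [MeasurableSpace Ω] {P : Measure Ω} [IsProbabilityMeasure P]
  [MeasurableSpace 𝒴] {Y : Ω → 𝒴} {e : Ω → Fin n → Fin n → ℝ} {u : 𝒴 → Fin n → Fin n → ℝ}

lemma measure_abs_sum_centeredLink_ge_le (hY : Measurable Y) (he : Measurable e)
    (hind : IndepFun e Y P) (hlaw : P.map e = shockLaw n)
    (hu : ∀ i j, Measurable (fun y => u y i j)) {τ : Fin n → Fin n × Fin n}
    (hτ : Function.Injective τ) {s : 𝒴 → Finset (Fin n)} (hs : ∀ k, MeasurableSet {y | k ∈ s y})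
    {ε : ℝ} (hε : 0 ≤ ε) :
    P {ω | ε * n ≤ |∑ k ∈ s (Y ω),
        centeredLink (u (Y ω) (τ k).1 (τ k).2) (e ω (τ k).1 (τ k).2)|} ≤ hoeffdingTail ε n := by
  refine measure_le_of_indepFun hY he hind (s := {p | ε * n ≤ |∑ k ∈ s p.1,
    centeredLink (u p.1 (τ k).1 (τ k).2) (p.2 (τ k).1 (τ k).2)|}) ?_ fun y => ?_
  · exact measurableSet_le measurable_const (measurable_sum_of_measurableSet_mem
      (fun k => measurable_fst (hs k)) fun k => measurable_centeredLink.comp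
        (((hu _ _).comp measurable_fst).prodMk (by fun_prop))).abs
  · rw [hlaw, ← ofReal_measureReal]
    exact ENNReal.ofReal_le_ofReal
      (shockLaw_real_abs_sum_centeredLink_ge_le hτ (fun k => u y (τ k).1 (τ k).2) (s y) hε)

lemma ae_add_shock_ne_zero (hY : Measurable Y) (he : Measurable e) (hind : IndepFun e Y P)
    (hlaw : P.map e = shockLaw n) (hu : ∀ i j, Measurable (fun y => u y i j)) (i j : Fin n) :
    ∀ᵐ ω ∂P, u (Y ω) i j + e ω i j ≠ 0 := by
  rw [ae_iff, ← nonpos_iff_eq_zero]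
  simp only [ne_eq, not_not]
  refine measure_le_of_indepFun hY he hind (s := {p | u p.1 i j + p.2 i j = 0}) ?_ fun y => ?_
  · exact measurableSet_eq_fun (((hu i j).comp measurable_fst).add (by fun_prop)) measurable_const
  · have hset : {t : Fin n → Fin n → ℝ | u y i j + t i j = 0}
        = (fun t => t i j) ⁻¹' {-(u y i j)} := Set.ext fun t => by
      rw [Set.mem_ofPred_eq, Set.mem_preimage, Set.mem_singleton_iff, eq_neg_iff_add_eq_zero,
        add_comm]
    have hnull := (measurePreserving_shock i j).measure_preimage
      (MeasurableSet.singleton (-(u y i j))).nullMeasurableSet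
    rw [logistic_singleton, ← hset] at hnull
    rw [hlaw]
    exact hnull.le

end Shocks

/-! ### The selected equilibrium -/

section Selection

lemma condExp_comp_prod_ae_eq_of_indepFun {Ω 𝒴 ℰ : Type*} [MeasurableSpace Ω] {P : Measure Ω}
    [IsProbabilityMeasure P] [m𝒴 : MeasurableSpace 𝒴] [MeasurableSpace ℰ] [StandardBorelSpace ℰ]
    [Nonempty ℰ] {Y : Ω → 𝒴} {e : Ω → ℰ} (hY : Measurable Y) (he : Measurable e)
    (hind : IndepFun e Y P) {f : 𝒴 × ℰ → ℝ} (hf : StronglyMeasurable f)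
    (hint : Integrable (fun ω => f (Y ω, e ω)) P) :
    P[fun ω => f (Y ω, e ω) | m𝒴.comap Y] =ᵐ[P] fun ω => ∫ t, f (Y ω, t) ∂(P.map e) := by
  have : IsProbabilityMeasure (P.map e) := Measure.isProbabilityMeasure_map he.aemeasurable
  have hlaw : P.map (fun ω => (Y ω, e ω)) = P.map Y ⊗ₘ Kernel.const 𝒴 (P.map e) := by
    rw [Measure.compProd_const,
      (indepFun_iff_map_prod_eq_prod_map_map hY.aemeasurable he.aemeasurable).1 hind.symm]
  have hcond : condDistrib e Y P =ᵐ[P.map Y] Kernel.const 𝒴 (P.map e) :=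
    condDistrib_ae_eq_of_measure_eq_compProd Y he.aemeasurable hlaw
  filter_upwards [condExp_prod_ae_eq_integral_condDistrib hY he.aemeasurable hf hint,
    ae_of_ae_map hY.aemeasurable hcond] with ω hω hωcond
  rw [hω, hωcond, Kernel.const_apply]

variable {𝕏 V Ω : Type*} [MeasurableSpace V] [MeasurableSpace Ω] {d n : ℕ}

/-- The variables on which the expected log-likelihood conditions: attributes, private types and
public signal. -/
def Sample.state (S : Sample 𝕏 V Ω n) (ω : Ω) : (Fin n → 𝕏) × (Fin n → ℝ) × V :=
  (S.X ω, S.A ω, S.signal ω)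

/-- The matrix `q` of mean link probabilities in the equilibrium selected at attributes `x` and
signal `v`. -/
noncomputable def selectedProb (F : (Fin n → 𝕏) → 𝕏 → Measure ℝ)
    (lam : (Fin n → 𝕏) → V → Belief n) (x : Fin n → 𝕏) (v : V) : Fin n → Fin n → ℝ :=
  meanLinkProb (fun i => F x (x i)) (lam x v)

/-- The indices at the true parameter and private types, as a function of the state; the link
from `i` to `j` is formed when this index plus the shock is positive. -/
noncomputable def selectedIndex (w : 𝕏 → 𝕏 → Fin d → ℝ) (β₀ : Param d)
    (F : (Fin n → 𝕏) → 𝕏 → Measure ℝ) (lam : (Fin n → 𝕏) → V → Belief n)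
    (y : (Fin n → 𝕏) × (Fin n → ℝ) × V) (i j : Fin n) : ℝ :=
  index w β₀ y.1 (selectedProb F lam y.1 y.2.2) (y.2.1 i) i j

variable {P : Measure Ω} {S : Sample 𝕏 V Ω n} {F : (Fin n → 𝕏) → 𝕏 → Measure ℝ}
  {w : 𝕏 → 𝕏 → Fin d → ℝ} {β₀ : Param d} {lam : (Fin n → 𝕏) → V → Belief n}

lemma Primitives.measurable_state [MeasurableSpace 𝕏] (h : Primitives P S F) :
    Measurable S.state :=
  h.measurable_X.prodMk (h.measurable_A.prodMk h.measurable_signal)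

namespace EquilibriumSelection

lemma measurable_belief (h : EquilibriumSelection P S F w β₀ lam) (x : Fin n → 𝕏) (v : V)
    (i : Fin n) (g : Action i) : Measurable (fun a => lam x v i a g) :=
  (h.measurable_lam x i g).comp measurable_prodMk_left

variable [∀ x s, IsProbabilityMeasure (F x s)]

lemma measurable_selectedProb (h : EquilibriumSelection P S F w β₀ lam) (x : Fin n → 𝕏)
    (i j : Fin n) : Measurable (fun v => selectedProb F lam x v i j) := by
  have hlink : Measurable (fun p : V × ℝ => linkProb (lam x p.1) i j p.2) := by
    unfold linkProb
    refine Finset.measurable_sum _ fun g _ => ?_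
    split_ifs
    exacts [h.measurable_lam x i g, measurable_const]
  exact (hlink.stronglyMeasurable.integral_prod_right' (ν := F x (x i))).measurable

variable [MeasurableSpace 𝕏] [Finite 𝕏] [MeasurableSingletonClass 𝕏]

lemma measurable_selectedIndex (h : EquilibriumSelection P S F w β₀ lam) (i j : Fin n) :
    Measurable (fun y => selectedIndex w β₀ F lam y i j) := by
  refine measurable_from_prod_countable_right fun x => ?_
  have hq : ∀ k l, Measurable (fun p : (Fin n → ℝ) × V => selectedProb F lam x p.2 k l) :=
    fun k l => (h.measurable_selectedProb x k l).comp measurable_snd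
  have hA : Measurable (fun p : (Fin n → ℝ) × V => p.1 i) := by fun_prop
  simp only [selectedIndex, index]
  exact ((hA.const_add _).add ((hq j i).mul_const _)).add
    (((Finset.measurable_sum _ fun k _ => hq j k).const_mul _).mul_const _)

variable [IsProbabilityMeasure P]

lemma ae_link_eq (h : EquilibriumSelection P S F w β₀ lam) (hprim : Primitives P S F) :
    ∀ᵐ ω ∂P, ∀ i j, i ≠ j → link (S.G ω) i j
      = if 0 < selectedIndex w β₀ F lam (S.state ω) i j + S.shock ω i j then 1 else 0 := by
  have hties : ∀ᵐ ω ∂P, ∀ i j,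
      selectedIndex w β₀ F lam (S.state ω) i j + S.shock ω i j ≠ 0 := by
    simp_rw [ae_all_iff]
    exact fun i j => ae_add_shock_ne_zero hprim.measurable_state hprim.measurable_shock
      hprim.indep_shock hprim.law_shock h.measurable_selectedIndex i j
  filter_upwards [hties, h.best_reply, h.equilibrium] with ω hties hbest heq i j hij
  refine link_eq_of_best_reply
    (v := selectedIndex w β₀ F lam (S.state ω) i + S.shock ω i) hij (fun g' => ?_) (hties i j)
  have hle := hbest i g'
  rwa [heq.expectedPayoff_eq (h.measurable_belief _ _),
    heq.expectedPayoff_eq (h.measurable_belief _ _)] at hle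

lemma ae_integral_link_eq (h : EquilibriumSelection P S F w β₀ lam) (hprim : Primitives P S F) :
    ∀ᵐ ω ∂P, ∀ i j, i ≠ j → ∫ g, link g i j ∂(condDistrib S.G S.state P (S.state ω))
      = Real.sigmoid (selectedIndex w β₀ F lam (S.state ω) i j) := by
  simp_rw [ae_all_iff]
  intro i j hij
  set f : ((Fin n → 𝕏) × (Fin n → ℝ) × V) × (Fin n → Fin n → ℝ) → ℝ :=
    fun p => if 0 < selectedIndex w β₀ F lam p.1 i j + p.2 i j then 1 else 0
  have hf : Measurable f := by
    have hu := h.measurable_selectedIndex i j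
    exact Measurable.ite (measurableSet_lt measurable_const (by fun_prop)) measurable_const
      measurable_const
  have hf_int : Integrable (fun ω => f (S.state ω, S.shock ω)) P :=
    Integrable.of_mem_Icc 0 1
      (hf.comp (hprim.measurable_state.prodMk hprim.measurable_shock)).aemeasurable
      (ae_of_all _ fun ω => by simp only [f]; split_ifs <;> simp)
  have hlink : (fun ω => link (S.G ω) i j) =ᵐ[P] fun ω => f (S.state ω, S.shock ω) := by
    filter_upwards [h.ae_link_eq hprim] with ω hω using hω i j hij
  filter_upwards [condExp_ae_eq_integral_condDistrib hprim.measurable_state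
      hprim.measurable_G.aemeasurable (StronglyMeasurable.of_discrete (f := fun g => link g i j))
      (hf_int.congr hlink.symm),
    condExp_congr_ae (m := MeasurableSpace.comap S.state inferInstance) hlink,
    condExp_comp_prod_ae_eq_of_indepFun hprim.measurable_state hprim.measurable_shock
      hprim.indep_shock hf.stronglyMeasurable hf_int] with ω hcond hcongr hprod
  rw [← hcond, hcongr, hprod, hprim.law_shock, ← integral_pos_add]
  exact integral_shock
    (f := fun t => if 0 < selectedIndex w β₀ F lam (S.state ω) i j + t then 1 else 0)
    (Measurable.ite (measurableSet_pos_add _) measurable_const measurable_const) i j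

lemma ae_expectedLogLik_eq (h : EquilibriumSelection P S F w β₀ lam)
    (hprim : Primitives P S F) :
    ∀ᵐ ω ∂P, ∀ β A, expectedLogLik P S F w lam ω β A
      = networkLik
        (fun i => choiceProb w β₀ (S.X ω) (selectedProb F lam (S.X ω) (S.signal ω)) (S.A ω i) i)
        (fun i => index w β (S.X ω) (selectedProb F lam (S.X ω) (S.signal ω)) (A i) i) := by
  filter_upwards [h.ae_integral_link_eq hprim] with ω hω β A
  simp only [expectedLogLik, logLik_eq_networkLik, networkLik, logitLik]
  rw [integral_const_mul, integral_finsetSum _ fun i _ => Integrable.of_finite]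
  congr 1
  refine Finset.sum_congr rfl fun i _ => ?_
  rw [integral_finsetSum _ fun j _ => Integrable.of_finite]
  refine Finset.sum_congr rfl fun j hj => ?_
  rw [integral_sub Integrable.of_finite (integrable_const _), integral_mul_const]
  rw [integral_const, probReal_univ, one_smul]
  exact congrArg (fun p => p * _ - _) (hω i j (Finset.ne_of_mem_erase hj).symm)

end EquilibriumSelection

end Selection

/-! ### Typical realizations have high probability -/

section TypeDeviation

/-- The deviation of the types `A k`, `k ∈ s`, from the law `μ`, as measured by the logistic
function shifted by `c`. -/
noncomputable def typeDeviation {ι : Type*} (μ : Measure ℝ) (s : Finset ι) (A : ι → ℝ)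
    (c : ℝ) : ℝ :=
  ∑ k ∈ s, (Real.sigmoid (c + A k) - ∫ a, Real.sigmoid (c + a) ∂μ)

lemma measurable_sigmoid_add (c : ℝ) : Measurable (fun a => Real.sigmoid (c + a)) :=
  continuous_sigmoid.measurable.comp (measurable_const_add c)

variable {ι : Type*} {μ : Measure ℝ}

lemma measurable_typeDeviation (s : Finset ι) (c : ℝ) :
    Measurable fun A : ι → ℝ => typeDeviation μ s A c :=
  Finset.measurable_sum _ fun k _ =>
    ((measurable_sigmoid_add c).comp (measurable_pi_apply k)).sub_const _

variable [IsProbabilityMeasure μ]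

lemma integrable_sigmoid_add (c : ℝ) : Integrable (fun a => Real.sigmoid (c + a)) μ :=
  Integrable.of_mem_Icc 0 1 (measurable_sigmoid_add c).aemeasurable
    (ae_of_all _ fun _ => ⟨Real.sigmoid_nonneg _, Real.sigmoid_le_one _⟩)

lemma integral_sigmoid_add_mem_Icc (c : ℝ) :
    ∫ a, Real.sigmoid (c + a) ∂μ ∈ Set.Icc (0 : ℝ) 1 := by
  refine ⟨integral_nonneg fun a => Real.sigmoid_nonneg _, ?_⟩
  simpa using integral_mono (μ := μ) (integrable_sigmoid_add c) (integrable_const 1)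
    fun a => Real.sigmoid_le_one _

lemma abs_integral_sigmoid_add_sub_le (c c' : ℝ) :
    |∫ a, Real.sigmoid (c + a) ∂μ - ∫ a, Real.sigmoid (c' + a) ∂μ| ≤ |c - c'| := by
  rw [← integral_sub (integrable_sigmoid_add c) (integrable_sigmoid_add c')]
  simpa using norm_integral_le_of_norm_le_const (μ := μ) (C := |c - c'|)
    (f := fun a => Real.sigmoid (c + a) - Real.sigmoid (c' + a)) (ae_of_all _ fun a =>
      (abs_sigmoid_sub_le _ _).trans_eq (congrArg _ (add_sub_add_right_eq_sub c c' a)))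

lemma abs_typeDeviation_sub_le (s : Finset ι) (A : ι → ℝ) (c c' : ℝ) :
    |typeDeviation μ s A c - typeDeviation μ s A c'| ≤ s.card * (2 * |c - c'|) := by
  rw [typeDeviation, typeDeviation, ← Finset.sum_sub_distrib, ← nsmul_eq_mul,
    ← Finset.sum_const]
  refine (Finset.abs_sum_le_sum_abs _ _).trans (Finset.sum_le_sum fun k _ => ?_)
  have htype : |Real.sigmoid (c + A k) - Real.sigmoid (c' + A k)| ≤ |c - c'| :=
    (abs_sigmoid_sub_le _ _).trans_eq (congrArg _ (add_sub_add_right_eq_sub c c' (A k)))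
  rw [sub_sub_sub_comm, two_mul]
  exact (abs_sub _ _).trans (add_le_add htype (abs_integral_sigmoid_add_sub_le c c'))

lemma pi_abs_typeDeviation_ge_le [Fintype ι] {ν : ι → Measure ℝ}
    [∀ k, IsProbabilityMeasure (ν k)] {s : Finset ι} (hs : ∀ k ∈ s, ν k = μ) {n : ℕ}
    (hn : s.card ≤ n) (c : ℝ) {ε : ℝ} (hε : 0 ≤ ε) :
    Measure.pi ν {A | ε * n ≤ |typeDeviation μ s A c|} ≤ hoeffdingTail ε n := by
  have hmeas : Measurable fun a => Real.sigmoid (c + a) - ∫ a, Real.sigmoid (c + a) ∂μ :=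
    (measurable_sigmoid_add c).sub_const _
  rw [← ofReal_measureReal]
  refine ENNReal.ofReal_le_ofReal (measureReal_abs_sum_ge_le
    (iIndepFun_pi (X := fun _ a => Real.sigmoid (c + a) - ∫ a, Real.sigmoid (c + a) ∂μ)
      fun _ => hmeas.aemeasurable)
    (fun k _ => (hmeas.comp (measurable_pi_apply k)).aemeasurable) (fun k _ A => ?_)
    (fun k hk => ?_) hn hε)
  · have hint := integral_sigmoid_add_mem_Icc (μ := μ) c
    have hsig := Real.sigmoid_nonneg (c + A k)
    have hsig' := Real.sigmoid_le_one (c + A k)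
    constructor <;> linarith [hint.1, hint.2]
  · rw [integral_comp_eval (μ := ν) hmeas.aestronglyMeasurable, hs k hk,
      integral_sub (integrable_sigmoid_add c) (integrable_const _), integral_const,
      probReal_univ, one_smul, sub_self]

end TypeDeviation

lemma exists_finset_net (C : ℝ) {δ : ℝ} (hδ : 0 < δ) :
    ∃ T : Finset ℝ, ∀ c, |c| ≤ C → ∃ t ∈ T, |c - t| ≤ δ := by
  obtain ⟨t, -, ht, hcover⟩ := finite_cover_balls_of_compact (isCompact_Icc (a := -C) (b := C)) hδ
  refine ⟨ht.toFinset, fun c hc => ?_⟩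
  obtain ⟨s, hs, hcs⟩ := Set.mem_iUnion₂.1 (hcover (abs_le.1 hc))
  exact ⟨s, ht.mem_toFinset.2 hs, (Metric.mem_ball.1 hcs).le⟩

lemma measure_exists_le {Ω ι : Type*} [MeasurableSpace Ω] {P : Measure Ω} [Finite ι]
    {p : ι → Ω → Prop} {b : ENNReal} (hp : ∀ i, P {ω | p i ω} ≤ b) :
    P {ω | ∃ i, p i ω} ≤ Nat.card ι * b := by
  cases nonempty_fintype ι
  rw [Nat.card_eq_fintype_card, Set.ofPred_exists, ← nsmul_eq_mul]
  exact (measure_iUnion_fintype_le _ _).trans (Finset.sum_le_card_nsmul _ _ _ fun i _ => hp i)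

section TypicalEvent

variable {𝕏 V Ω : Type*} [MeasurableSpace 𝕏] [MeasurableSingletonClass 𝕏]
  [MeasurableSpace V] [MeasurableSpace Ω] {d n : ℕ} {P : Measure Ω} [IsProbabilityMeasure P]
  {S : Sample 𝕏 V Ω n} {F : (Fin n → 𝕏) → 𝕏 → Measure ℝ}

namespace Primitives

variable [Finite 𝕏]

lemma measure_types_mem_le (h : Primitives P S F) {s : (Fin n → 𝕏) → Set (Fin n → ℝ)}
    (hs : ∀ x, MeasurableSet (s x)) {b : ENNReal}
    (hb : ∀ x, Measure.pi (fun i => F x (x i)) (s x) ≤ b) : P {ω | S.A ω ∈ s (S.X ω)} ≤ b := by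
  cases nonempty_fintype 𝕏
  have hcover : {ω | S.A ω ∈ s (S.X ω)} ⊆ ⋃ x, {ω | S.X ω = x ∧ S.A ω ∈ s x} :=
    fun ω hω => Set.mem_iUnion.2 ⟨S.X ω, rfl, hω⟩
  calc P {ω | S.A ω ∈ s (S.X ω)} ≤ ∑ x, P {ω | S.X ω = x ∧ S.A ω ∈ s x} :=
        (measure_mono hcover).trans (measure_iUnion_fintype_le _ _)
    _ = ∑ x, P {ω | S.X ω = x} * Measure.pi (fun i => F x (x i)) (s x) :=
        Finset.sum_congr rfl fun x _ => h.law_A x _ (hs x)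
    _ ≤ ∑ x, P (S.X ⁻¹' {x}) * b := Finset.sum_le_sum fun x _ => mul_le_mul_right (hb x) _
    _ = b := by
        rw [← Finset.sum_mul, sum_measure_preimage_singleton _ fun x _ =>
          h.measurable_X (MeasurableSet.singleton x)]
        simp

variable [∀ x s, IsProbabilityMeasure (F x s)]

lemma ae_types_mem (h : Primitives P S F) {𝔸 : Set ℝ} (hF𝔸 : ∀ x s, F x s 𝔸ᶜ = 0) :
    ∀ᵐ ω ∂P, ∀ i, S.A ω i ∈ 𝔸 := by
  refine ae_all_iff.2 fun i => ae_iff.2 (nonpos_iff_eq_zero.1 ?_)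
  refine (measure_mono fun ω hω => ?_).trans (h.measure_types_mem_le
    (s := fun x => {a | a i ∈ toMeasurable (F x (x i)) 𝔸ᶜ})
    (fun x => measurable_pi_apply i (measurableSet_toMeasurable _ _)) fun x => ?_)
  · exact subset_toMeasurable _ _ hω
  · have hnull := (measurePreserving_eval (fun i => F x (x i)) i).measure_preimage
      (measurableSet_toMeasurable (F x (x i)) 𝔸ᶜ).nullMeasurableSet
    rw [measure_toMeasurable, hF𝔸] at hnull
    exact hnull.le

variable [DecidableEq 𝕏]

lemma measure_abs_typeDeviation_ge_le (h : Primitives P S F) (s : 𝕏) (c : ℝ) {ε : ℝ}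
    (hε : 0 ≤ ε) :
    P {ω | ε * n ≤ |typeDeviation (F (S.X ω) s) {k | S.X ω k = s} (S.A ω) c|}
      ≤ hoeffdingTail ε n := by
  refine h.measure_types_mem_le
    (s := fun x => {A | ε * n ≤ |typeDeviation (F x s) {k | x k = s} A c|})
    (fun x => measurableSet_le measurable_const (measurable_typeDeviation _ _).abs) fun x =>
      pi_abs_typeDeviation_ge_le (fun k hk => ?_)
        ((Finset.card_le_univ _).trans_eq (Fintype.card_fin n)) c hε
  rw [(Finset.mem_filter.1 hk).2]

lemma measure_exists_abs_typeDeviation_gt_le (h : Primitives P S F) {ε C : ℝ} (hε : 0 ≤ ε)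
    {T : Finset ℝ} (hT : ∀ c, |c| ≤ C → ∃ t ∈ T, |c - t| ≤ ε / 4) :
    P {ω | ∃ s c, |c| ≤ C ∧
        ε * n < |typeDeviation (F (S.X ω) s) {k | S.X ω k = s} (S.A ω) c|}
      ≤ (Nat.card (𝕏 × T) : ENNReal) * hoeffdingTail (ε / 2) n := by
  refine (measure_mono ?_).trans (measure_exists_le fun p : 𝕏 × T =>
    h.measure_abs_typeDeviation_ge_le p.1 p.2 (by positivity))
  rintro ω ⟨s, c, hc, hdev⟩
  obtain ⟨t, ht, hct⟩ := hT c hc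
  refine ⟨(s, ⟨t, ht⟩), ?_⟩
  have hlip := abs_typeDeviation_sub_le (μ := F (S.X ω) s) {k | S.X ω k = s} (S.A ω) c t
  have hcard : (Finset.card {k | S.X ω k = s} : ℝ) ≤ n := by
    exact_mod_cast (Finset.card_le_univ _).trans_eq (Fintype.card_fin n)
  have hnet : (Finset.card {k | S.X ω k = s} : ℝ) * (2 * |c - t|) ≤ n * (2 * (ε / 4)) := by
    gcongr
  change ε / 2 * n ≤ |typeDeviation (F (S.X ω) s) {k | S.X ω k = s} (S.A ω) t|
  linarith [abs_sub_abs_le_abs_sub (typeDeviation (F (S.X ω) s) {k | S.X ω k = s} (S.A ω) c)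
    (typeDeviation (F (S.X ω) s) {k | S.X ω k = s} (S.A ω) t)]

end Primitives

namespace EquilibriumSelection

variable [∀ x s, IsProbabilityMeasure (F x s)] [DecidableEq 𝕏] {w : 𝕏 → 𝕏 → Fin d → ℝ}
  {β₀ : Param d} {lam : (Fin n → 𝕏) → V → Belief n}

lemma measure_exists_abs_sum_centeredLink_ge_le [Finite 𝕏]
    (h : EquilibriumSelection P S F w β₀ lam) (hprim : Primitives P S F)
    {τ : Fin n → Fin n → Fin n × Fin n} (hτ : ∀ l, Function.Injective (τ l)) {ε : ℝ} (hε : 0 ≤ ε) :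
    P {ω | ∃ p : Fin n × 𝕏, ε * n ≤ |∑ k ∈ others (S.X ω) p.2 p.1,
        centeredLink (selectedIndex w β₀ F lam (S.state ω) (τ p.1 k).1 (τ p.1 k).2)
          (S.shock ω (τ p.1 k).1 (τ p.1 k).2)|}
      ≤ (Nat.card (Fin n × 𝕏) : ENNReal) * hoeffdingTail ε n := by
  refine measure_exists_le fun p => measure_abs_sum_centeredLink_ge_le hprim.measurable_state
    hprim.measurable_shock hprim.indep_shock hprim.law_shock h.measurable_selectedIndex
    (hτ p.1) (s := fun y => others y.1 p.2 p.1) (fun k => ?_) hε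
  simp only [mem_others]
  exact measurable_fst (MeasurableSet.of_discrete (s := {x : Fin n → 𝕏 | k ≠ p.1 ∧ x k = p.2}))

variable [Fintype 𝕏]

lemma ae_isTypical (h : EquilibriumSelection P S F w β₀ lam) (hprim : Primitives P S F)
    (ε : ℝ) :
    ∀ᵐ ω ∂P,
      (∀ l s, |∑ k ∈ others (S.X ω) s l,
        centeredLink (selectedIndex w β₀ F lam (S.state ω) k l) (S.shock ω k l)| ≤ ε * n) →
      (∀ i t, |∑ j ∈ others (S.X ω) t i,
        centeredLink (selectedIndex w β₀ F lam (S.state ω) i j) (S.shock ω i j)| ≤ ε * n) →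
      (∀ s c, |c| ≤ indexLip w * ‖β₀‖ →
        |typeDeviation (F (S.X ω) s) {k | S.X ω k = s} (S.A ω) c| ≤ ε * n) →
      IsTypical w β₀ (S.X ω) (S.A ω) (S.G ω) (selectedProb F lam (S.X ω) (S.signal ω)) ε := by
  filter_upwards [h.ae_link_eq hprim, h.equilibrium, h.symmetric] with ω hlink heq hsym hcol hrow
    htype
  set q := selectedProb F lam (S.X ω) (S.signal ω)
  have hmem : ∀ i j, q i j ∈ Set.Icc (0 : ℝ) 1 :=
    heq.meanLinkProb_mem_Icc (h.measurable_belief _ _)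
  have hcent : ∀ i j, i ≠ j → link (S.G ω) i j - choiceProb w β₀ (S.X ω) q (S.A ω i) i j
      = centeredLink (selectedIndex w β₀ F lam (S.state ω) i j) (S.shock ω i j) :=
    fun i j hij => by rw [hlink i j hij]; rfl
  refine ⟨hmem, hsym.isAttributeFunction, fun l s => ?_, fun i t => ?_, fun i j hij => ?_⟩
  · rw [Finset.sum_congr rfl fun k hk => hcent k l (mem_others.1 hk).1]
    exact hcol l s
  · rw [Finset.sum_congr rfl fun k hk => hcent i k (mem_others.1 hk).1.symm]
    exact hrow i t
  · have hbound := abs_index_le w hmem hij (S.X ω) β₀ 0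
    rw [abs_zero, add_zero] at hbound
    have hmean : ∫ a, Real.sigmoid (index w β₀ (S.X ω) q a i j) ∂(F (S.X ω) (S.X ω i)) = q i j :=
      heq.integral_choiceProb (h.measurable_belief _ _) hij
    have hdev := htype (S.X ω i) _ hbound
    simp only [typeDeviation, ← index_eq_add, hmean] at hdev
    exact hdev

lemma measure_not_isTypical_le (h : EquilibriumSelection P S F w β₀ lam)
    (hprim : Primitives P S F) {ε : ℝ} (hε : 0 ≤ ε) {T : Finset ℝ}
    (hT : ∀ c, |c| ≤ indexLip w * ‖β₀‖ → ∃ t ∈ T, |c - t| ≤ ε / 4) :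
    P {ω | ¬ IsTypical w β₀ (S.X ω) (S.A ω) (S.G ω) (selectedProb F lam (S.X ω) (S.signal ω)) ε}
      ≤ (Nat.card (Fin n × 𝕏) : ENNReal) * hoeffdingTail ε n
        + (Nat.card (Fin n × 𝕏) : ENNReal) * hoeffdingTail ε n
        + (Nat.card (𝕏 × T) : ENNReal) * hoeffdingTail (ε / 2) n := by
  have hcol := h.measure_exists_abs_sum_centeredLink_ge_le hprim
    (τ := fun l k => (k, l)) (fun l _ _ hk => congrArg Prod.fst hk) hε
  have hrow := h.measure_exists_abs_sum_centeredLink_ge_le hprim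
    (τ := Prod.mk) Prod.mk_right_injective hε
  refine le_trans (measure_mono_ae ?_) ((measure_union_le _ _).trans (add_le_add
    ((measure_union_le _ _).trans (add_le_add hcol hrow))
    (hprim.measure_exists_abs_typeDeviation_gt_le hε hT)))
  filter_upwards [h.ae_isTypical hprim ε] with ω hω hnot
  by_contra hcon
  obtain ⟨hcon, htype⟩ := not_or.1 hcon
  obtain ⟨hcol, hrow⟩ := not_or.1 hcon
  exact hnot (hω (fun l s => (not_le.1 fun hle => hcol ⟨(l, s), hle⟩).le)
    (fun i t => (not_le.1 fun hle => hrow ⟨(i, t), hle⟩).le)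
    fun s c hc => not_lt.1 fun hlt => htype ⟨s, c, hc, hlt⟩)

end EquilibriumSelection

end TypicalEvent

/-! ### Consistency -/

section FixedSize

variable {𝕏 V Ω : Type*} [Fintype 𝕏] [DecidableEq 𝕏] [MeasurableSpace 𝕏] [MeasurableSpace V]
  [MeasurableSpace Ω] {d n : ℕ} {P : Measure Ω} [IsProbabilityMeasure P] {S : Sample 𝕏 V Ω n}
  {F : (Fin n → 𝕏) → 𝕏 → Measure ℝ} {w : 𝕏 → 𝕏 → Fin d → ℝ} {β₀ : Param d}
  {lam : (Fin n → 𝕏) → V → Belief n} {B : Set (Param d)} {𝔸 : Set ℝ} {R RA ε r : ℝ}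

lemma IsTypical.norm_sub_lt {ω : Ω} {η : ℝ}
    (h : IsTypical w β₀ (S.X ω) (S.A ω) (S.G ω) (selectedProb F lam (S.X ω) (S.signal ω)) ε)
    (hlik : ∀ β A, expectedLogLik P S F w lam ω β A
      = networkLik
        (fun i => choiceProb w β₀ (S.X ω) (selectedProb F lam (S.X ω) (S.signal ω)) (S.A ω i) i)
        (fun i => index w β (S.X ω) (selectedProb F lam (S.X ω) (S.signal ω)) (A i) i))
    (hn : 3 ≤ n) (hεn : 1 ≤ ε * n) (hB : ∀ β ∈ B, ‖β‖ ≤ R) (h𝔸 : ∀ a ∈ 𝔸, |a| ≤ RA)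
    (hβ₀ : β₀ ∈ B) (hA₀ : ∀ i, S.A ω i ∈ 𝔸) (hsep : SeparatedMaximum P S F w lam B 𝔸 β₀ r η ω)
    (hη : 2 * (Fintype.card 𝕏 * (48 * R + 2 * (indexLip w * R + RA)) * ε) < η)
    {β : Param d} {A : Fin n → ℝ} (hmle : IsTwoStepMLE w B 𝔸 (S.X ω) (S.G ω) β A) :
    ‖β - β₀‖ < r := by
  obtain ⟨hβ, hA, hmax⟩ := hmle
  by_contra! hfar
  have hdist : r ≤ ‖β - β₀‖ + (n : ℝ)⁻¹ * ∑ i, |A i - S.A ω i| :=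
    hfar.trans (le_add_of_nonneg_right (by positivity))
  have hgap := hsep β hβ A hA hdist
  rw [hlik, hlik] at hgap
  have hclose := abs_le.1 (h.abs_logLik_sub_le hn hεn (hB β hβ) (fun i => h𝔸 _ (hA i)))
  have hclose₀ := abs_le.1 (h.abs_logLik_sub_le hn hεn (hB β₀ hβ₀) (fun i => h𝔸 _ (hA₀ i)))
  linarith [hclose.2, hclose₀.1, hmax β₀ hβ₀ (S.A ω) hA₀]

variable [MeasurableSingletonClass 𝕏] [∀ x s, IsProbabilityMeasure (F x s)]
  {βhat : Ω → Param d} {Ahat : Ω → Fin n → ℝ}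

lemma EquilibriumSelection.measure_le_norm_sub_le (h : EquilibriumSelection P S F w β₀ lam)
    (hprim : Primitives P S F) (hF𝔸 : ∀ x s, F x s 𝔸ᶜ = 0) (hn : 3 ≤ n) (hεn : 1 ≤ ε * n)
    (hB : ∀ β ∈ B, ‖β‖ ≤ R) (h𝔸 : ∀ a ∈ 𝔸, |a| ≤ RA) (hβ₀ : β₀ ∈ B) {η : ℝ}
    (hη : 2 * (Fintype.card 𝕏 * (48 * R + 2 * (indexLip w * R + RA)) * ε) < η)
    (hmle : ∀ᵐ ω ∂P, IsTwoStepMLE w B 𝔸 (S.X ω) (S.G ω) (βhat ω) (Ahat ω)) :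
    P {ω | r ≤ ‖βhat ω - β₀‖}
      ≤ P {ω | ¬ SeparatedMaximum P S F w lam B 𝔸 β₀ r η ω}
        + P {ω | ¬ IsTypical w β₀ (S.X ω) (S.A ω) (S.G ω)
          (selectedProb F lam (S.X ω) (S.signal ω)) ε} := by
  refine (measure_mono_ae ?_).trans (measure_union_le _ _)
  filter_upwards [hmle, h.ae_expectedLogLik_eq hprim, hprim.ae_types_mem hF𝔸]
    with ω hmleω hlik hA₀ hfar
  by_contra hcon
  obtain ⟨hsep, htyp⟩ := not_or.1 hcon
  exact ((not_not.1 htyp).norm_sub_lt hlik hn hεn hB h𝔸 hβ₀ hA₀ (not_not.1 hsep) hη hmleω).not_ge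
    hfar

lemma Primitives.measure_exists_le_abs_type_sub_le (hprim : Primitives P S F)
    (hF𝔸 : ∀ x s, F x s 𝔸ᶜ = 0) (hn : 3 ≤ n) (hεn : 1 ≤ ε * n) (hB : ∀ β ∈ B, ‖β‖ ≤ R)
    (h𝔸 : ∀ a ∈ 𝔸, |a| ≤ RA) {ρ : ℝ}
    (hρ : Fintype.card 𝕏 * (2 + 24 * R) * ε + indexLip w * ρ
      < curvature (indexLip w * R + RA) / 2 * r)
    (hmle : ∀ᵐ ω ∂P, IsTwoStepMLE w B 𝔸 (S.X ω) (S.G ω) (βhat ω) (Ahat ω)) :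
    P {ω | ∃ i, r ≤ |Ahat ω i - S.A ω i|}
      ≤ P {ω | ρ ≤ ‖βhat ω - β₀‖}
        + P {ω | ¬ IsTypical w β₀ (S.X ω) (S.A ω) (S.G ω)
          (selectedProb F lam (S.X ω) (S.signal ω)) ε} := by
  refine (measure_mono_ae ?_).trans (measure_union_le _ _)
  filter_upwards [hmle, hprim.ae_types_mem hF𝔸] with ω hmleω hA₀ ⟨i, hi⟩
  by_contra hcon
  obtain ⟨hnear, htyp⟩ := not_or.1 hcon
  have hnear : ‖βhat ω - β₀‖ ≤ ρ := (not_le.1 hnear).le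
  refine hρ.not_ge ?_
  calc curvature (indexLip w * R + RA) / 2 * r
      ≤ curvature (indexLip w * R + RA) / 2 * |Ahat ω i - S.A ω i| :=
        mul_le_mul_of_nonneg_left hi (half_pos (curvature_pos _)).le
    _ ≤ Fintype.card 𝕏 * (2 + 24 * R) * ε + indexLip w * ‖βhat ω - β₀‖ :=
        (not_not.1 htyp).curvature_mul_abs_type_sub_le hn hεn hB h𝔸 hA₀ hmleω i
    _ ≤ _ := add_le_add_right (mul_le_mul_of_nonneg_left hnear (indexLip_pos w).le) _

end FixedSize

section Limit

lemma eventually_one_le_mul_natCast {ε : ℝ} (hε : 0 < ε) : ∀ᶠ n : ℕ in atTop, 1 ≤ ε * n :=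
  (tendsto_natCast_atTop_atTop.const_mul_atTop hε).eventually_ge_atTop 1

variable {𝕏 : Type*} [Finite 𝕏] [DecidableEq 𝕏] [MeasurableSpace 𝕏]
  [MeasurableSingletonClass 𝕏] {d : ℕ}
  {Ω : ℕ → Type*} [∀ n, MeasurableSpace (Ω n)]
  {P : (n : ℕ) → Measure (Ω n)} [∀ n, IsProbabilityMeasure (P n)]
  {V : ℕ → Type*} [∀ n, MeasurableSpace (V n)] {w : 𝕏 → 𝕏 → Fin d → ℝ}
  {S : (n : ℕ) → Sample 𝕏 (V n) (Ω n) n} {F : (n : ℕ) → (Fin n → 𝕏) → 𝕏 → Measure ℝ}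
  [∀ n x s, IsProbabilityMeasure (F n x s)] {β₀ : Param d}
  {lam : (n : ℕ) → (Fin n → 𝕏) → V n → Belief n}

lemma tendsto_measure_not_isTypical (hprim : ∀ n, Primitives (P n) (S n) (F n))
    (hsel : ∀ᶠ n in atTop, EquilibriumSelection (P n) (S n) (F n) w β₀ (lam n))
    {ε : ℝ} (hε : 0 < ε) :
    Tendsto (fun n => P n {ω | ¬ IsTypical w β₀ ((S n).X ω) ((S n).A ω) ((S n).G ω)
      (selectedProb (F n) (lam n) ((S n).X ω) ((S n).signal ω)) ε}) atTop (𝓝 0) := by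
  cases nonempty_fintype 𝕏
  obtain ⟨T, hT⟩ := exists_finset_net (indexLip w * ‖β₀‖) (show 0 < ε / 4 by linarith)
  have hlinks : Tendsto (fun n : ℕ => (Nat.card (Fin n × 𝕏) : ENNReal) * hoeffdingTail ε n)
      atTop (𝓝 0) := by
    simpa [Nat.card_prod, mul_assoc, mul_left_comm] using ENNReal.Tendsto.const_mul
      (tendsto_pow_mul_hoeffdingTail 1 hε) (Or.inr (ENNReal.natCast_ne_top (Nat.card 𝕏)))
  have htypes : Tendsto (fun n : ℕ => (Nat.card (𝕏 × T) : ENNReal) * hoeffdingTail (ε / 2) n)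
      atTop (𝓝 0) := by
    simpa only [pow_zero, one_mul, mul_zero] using ENNReal.Tendsto.const_mul
      (tendsto_pow_mul_hoeffdingTail 0 (half_pos hε))
      (Or.inr (ENNReal.natCast_ne_top (Nat.card (𝕏 × T))))
  have hbound := (hlinks.add hlinks).add htypes
  rw [add_zero, add_zero] at hbound
  refine tendsto_of_tendsto_of_tendsto_of_le_of_le' tendsto_const_nhds hbound
    (Eventually.of_forall fun _ => zero_le) ?_
  filter_upwards [hsel] with n hn using hn.measure_not_isTypical_le (hprim n) hε.le hT

variable {B : Set (Param d)} {𝔸 : Set ℝ} {R RA : ℝ} {βhat : (n : ℕ) → Ω n → Param d}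
  {Ahat : (n : ℕ) → Ω n → Fin n → ℝ}

lemma tendsto_measure_le_norm_sub (hprim : ∀ n, Primitives (P n) (S n) (F n))
    (hF𝔸 : ∀ n x s, F n x s 𝔸ᶜ = 0)
    (hB : ∀ β ∈ B, ‖β‖ ≤ R) (h𝔸 : ∀ a ∈ 𝔸, |a| ≤ RA) (hβ₀ : β₀ ∈ B)
    (hsel : ∀ᶠ n in atTop, EquilibriumSelection (P n) (S n) (F n) w β₀ (lam n)) {r : ℝ}
    (hident : ∀ δ > 0, ∃ η > 0, ∀ᶠ n in atTop,
      P n {ω | ¬ SeparatedMaximum (P n) (S n) (F n) w (lam n) B 𝔸 β₀ r η ω} ≤ ENNReal.ofReal δ)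
    (hmle : ∀ᶠ n in atTop, ∀ᵐ ω ∂(P n),
      IsTwoStepMLE w B 𝔸 ((S n).X ω) ((S n).G ω) (βhat n ω) (Ahat n ω)) :
    Tendsto (fun n => P n {ω | r ≤ ‖βhat n ω - β₀‖}) atTop (𝓝 0) := by
  cases nonempty_fintype 𝕏
  refine ENNReal.tendsto_nhds_zero.2 fun δ hδ => ?_
  have hδ2 : 0 < δ / 2 := ENNReal.half_pos hδ.ne'
  obtain ⟨δ', hδ'0, hδ'⟩ := ENNReal.lt_iff_exists_nnreal_btwn.1 hδ2
  obtain ⟨η, hη, hsep⟩ := hident δ' (by exact_mod_cast hδ'0)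
  rw [ENNReal.ofReal_coe_nnreal] at hsep
  obtain ⟨ε, hε, hεη⟩ := exists_pos_mul_lt hη
    (2 * (Fintype.card 𝕏 * (48 * R + 2 * (indexLip w * R + RA))))
  rw [mul_assoc] at hεη
  filter_upwards [hsep, hsel, hmle, eventually_ge_atTop 3, eventually_one_le_mul_natCast hε,
    ENNReal.tendsto_nhds_zero.1 (tendsto_measure_not_isTypical hprim hsel hε) _ hδ2]
    with n hsepn hseln hmlen hn hεn htyp
  calc P n {ω | r ≤ ‖βhat n ω - β₀‖} ≤ _ :=
        hseln.measure_le_norm_sub_le (hprim n) (hF𝔸 n) hn hεn hB h𝔸 hβ₀ hεη hmlen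
    _ ≤ δ / 2 + δ / 2 := add_le_add (hsepn.trans hδ'.le) htyp
    _ = δ := ENNReal.add_halves δ

lemma tendsto_measure_exists_le_abs_type_sub (hprim : ∀ n, Primitives (P n) (S n) (F n))
    (hF𝔸 : ∀ n x s, F n x s 𝔸ᶜ = 0)
    (hB : ∀ β ∈ B, ‖β‖ ≤ R) (h𝔸 : ∀ a ∈ 𝔸, |a| ≤ RA)
    (hsel : ∀ᶠ n in atTop, EquilibriumSelection (P n) (S n) (F n) w β₀ (lam n))
    (hmle : ∀ᶠ n in atTop, ∀ᵐ ω ∂(P n),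
      IsTwoStepMLE w B 𝔸 ((S n).X ω) ((S n).G ω) (βhat n ω) (Ahat n ω))
    (hβhat : ∀ r > 0, Tendsto (fun n => P n {ω | r ≤ ‖βhat n ω - β₀‖}) atTop (𝓝 0))
    {r : ℝ} (hr : 0 < r) :
    Tendsto (fun n => P n {ω | ∃ i, r ≤ |Ahat n ω i - (S n).A ω i|}) atTop (𝓝 0) := by
  cases nonempty_fintype 𝕏
  have hgap : 0 < curvature (indexLip w * R + RA) / 2 * r :=
    mul_pos (half_pos (curvature_pos _)) hr
  obtain ⟨ε, hε, hεgap⟩ := exists_pos_mul_lt (half_pos hgap) (Fintype.card 𝕏 * (2 + 24 * R))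
  obtain ⟨ρ, hρ, hρgap⟩ := exists_pos_mul_lt (half_pos hgap) (indexLip w)
  have hlim := (hβhat ρ hρ).add (tendsto_measure_not_isTypical hprim hsel hε)
  rw [add_zero] at hlim
  refine tendsto_of_tendsto_of_tendsto_of_le_of_le' tendsto_const_nhds hlim
    (Eventually.of_forall fun _ => zero_le) ?_
  filter_upwards [hmle, eventually_ge_atTop 3, eventually_one_le_mul_natCast hε]
    with n hmlen hn hεn
  exact (hprim n).measure_exists_le_abs_type_sub_le (hF𝔸 n) hn hεn hB h𝔸 (by linarith) hmlen

end Limit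

end NetFormation

open NetFormation in
theorem theorem1_general {𝕏 : Type*} [Finite 𝕏] [DecidableEq 𝕏] [MeasurableSpace 𝕏]
    [MeasurableSingletonClass 𝕏] {d : ℕ}
    {Ω : ℕ → Type*} [∀ n, MeasurableSpace (Ω n)]
    (P : (n : ℕ) → Measure (Ω n)) [∀ n, IsProbabilityMeasure (P n)]
    {V : ℕ → Type*} [∀ n, MeasurableSpace (V n)]
    (w : 𝕏 → 𝕏 → Fin d → ℝ)
    (S : (n : ℕ) → Sample 𝕏 (V n) (Ω n) n)
    (F : (n : ℕ) → (Fin n → 𝕏) → 𝕏 → Measure ℝ)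
    (hF : ∀ n x s, IsProbabilityMeasure (F n x s))
    (hprim : ∀ n, Primitives (P n) (S n) (F n))
    (𝔸 : Set ℝ) (h𝔸 : Bornology.IsBounded 𝔸) (hF𝔸 : ∀ n x s, F n x s 𝔸ᶜ = 0)
    (B : Set (Param d)) (hB : Bornology.IsBounded B) (β₀ : Param d) (hβ₀ : β₀ ∈ B)
    (lam : (n : ℕ) → (Fin n → 𝕏) → V n → Belief n)
    (hsel : ∀ᶠ n in atTop, EquilibriumSelection (P n) (S n) (F n) w β₀ (lam n))
    (hident : ∀ r > 0, ∀ δ > 0, ∃ η > 0, ∀ᶠ n in atTop,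
      P n {ω | ¬ SeparatedMaximum (P n) (S n) (F n) w (lam n) B 𝔸 β₀ r η ω} ≤ ENNReal.ofReal δ)
    (βhat : (n : ℕ) → Ω n → Param d) (Ahat : (n : ℕ) → Ω n → Fin n → ℝ)
    (hmle : ∀ᶠ n in atTop, ∀ᵐ ω ∂(P n),
      IsTwoStepMLE w B 𝔸 ((S n).X ω) ((S n).G ω) (βhat n ω) (Ahat n ω)) :
    (∀ r > 0, Tendsto (fun n => P n {ω | r ≤ ‖βhat n ω - β₀‖}) atTop (𝓝 0)) ∧
    (∀ r > 0, Tendsto (fun n => P n {ω | ∃ i, r ≤ |Ahat n ω i - (S n).A ω i|}) atTop (𝓝 0)) := by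
  obtain ⟨R, hR⟩ := hB.exists_norm_le
  obtain ⟨RA, hRA⟩ := h𝔸.exists_norm_le
  have hβhat : ∀ r > 0, Tendsto (fun n => P n {ω | r ≤ ‖βhat n ω - β₀‖}) atTop (𝓝 0) :=
    fun r hr => tendsto_measure_le_norm_sub hprim hF𝔸 hR hRA hβ₀ hsel (hident r hr) hmle
  exact ⟨hβhat, fun r hr =>
    tendsto_measure_exists_le_abs_type_sub hprim hF𝔸 hR hRA hsel hmle hβhat hr⟩

open NetFormation in
theorem theorem1 {𝕏 : Type*} [Fintype 𝕏] [DecidableEq 𝕏] [MeasurableSpace 𝕏]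
    [MeasurableSingletonClass 𝕏] {d : ℕ}
    {Ω : ℕ → Type*} [∀ n, MeasurableSpace (Ω n)]
    (P : (n : ℕ) → Measure (Ω n)) [∀ n, IsProbabilityMeasure (P n)]
    {V : ℕ → Type*} [∀ n, MeasurableSpace (V n)]
    (w : 𝕏 → 𝕏 → Fin d → ℝ)
    (S : (n : ℕ) → Sample 𝕏 (V n) (Ω n) n)
    (F : (n : ℕ) → (Fin n → 𝕏) → 𝕏 → Measure ℝ)
    (hF : ∀ n x s, IsProbabilityMeasure (F n x s))
    (hprim : ∀ n, Primitives (P n) (S n) (F n))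
    (𝔸 : Set ℝ) (h𝔸 : IsCompact 𝔸) (hF𝔸 : ∀ n x s, F n x s 𝔸ᶜ = 0)
    (B : Set (Param d)) (hB : IsCompact B) (β₀ : Param d) (hβ₀ : β₀ ∈ interior B)
    (lam : (n : ℕ) → (Fin n → 𝕏) → V n → Belief n)
    (hsel : ∀ᶠ n in atTop, EquilibriumSelection (P n) (S n) (F n) w β₀ (lam n))
    (hident : ∀ r > 0, ∀ δ > 0, ∃ η > 0, ∀ᶠ n in atTop,
      P n {ω | ¬ SeparatedMaximum (P n) (S n) (F n) w (lam n) B 𝔸 β₀ r η ω} ≤ ENNReal.ofReal δ)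
    (βhat : (n : ℕ) → Ω n → Param d) (Ahat : (n : ℕ) → Ω n → Fin n → ℝ)
    (hmle : ∀ᶠ n in atTop, ∀ᵐ ω ∂(P n),
      IsTwoStepMLE w B 𝔸 ((S n).X ω) ((S n).G ω) (βhat n ω) (Ahat n ω)) :
    (∀ r > 0, Tendsto (fun n => P n {ω | r ≤ ‖βhat n ω - β₀‖}) atTop (𝓝 0)) ∧
    (∀ r > 0, Tendsto (fun n => P n {ω | ∃ i, r ≤ |Ahat n ω i - (S n).A ω i|}) atTop (𝓝 0)) :=
  theorem1_general P w S F hF hprim 𝔸 h𝔸.isBounded hF𝔸 B hB.isBounded β₀ (interior_subset hβ₀) lam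
    hsel hident βhat Ahat hmle
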